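/- In the online metric Steiner tree problem, points $x_0,x_1,x_2,\dots$ of a metric space $(X,d)$ are revealed one by one; when $x_n$ arrives, its distances to $x_0,\dots,x_{n-1}$ are revealed. A deterministic online algorithm must then output a graph $T_n$ on the vertex set $\{0,\dots,n\}$ that depends only on the distances $d(x_i,x_j)$, $0\le i,j\le n$. The cost of $T_n$ is the sum of $d(x_i,x_j)$ over its edges $ij$. Let $\mathrm{OPT}_n$ be the optimal Steiner tree cost for $\{x_0,\dots,x_n\}$, that is, the infimum of the costs (total edge lengths) of the trees whose vertex set is a finite subset of $X$ containing $\{x_0,\dots,x_n\}$. Theorem. Let $\alpha\ge 6$ be a real number for which $K=2\alpha^2$ is an integer (for example $\alpha=6$, $K=72$). There is an online algorithm such that, for every metric space $(X,d)$, every sequence of points $x_0,x_1,\dots$ in $X$ and every $n\ge 0$: 1. $T_n$ is a spanning tree on $\{0,\dots,n\}$; 2. $T_{n+1}$ is obtained from $T_n$ by adding an edge that joins the new vertex $n+1$ to one of the vertices $0,\dots,n$, and then performing at most one edge swap (removing one edge and adding another one); 3. the cost of $T_n$ is at most $$\frac{2\,\alpha^{4K+2}}{(\alpha-1)(\alpha^K-1)}\cdot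 \mathrm{OPT}_n .$$ In particular, there is an online algorithm that performs at most one edge swap upon each arrival and always maintains a spanning tree of cost at most a universal constant times the cost of an optimal Steiner tree on the current points. -/

import Mathlib

namespace OnlineSteiner

/-- A deterministic online algorithm for the metric Steiner tree problem.  The arriving points are
numbered `0, 1, 2, …`.  After the arrival of point `n` the algorithm outputs a graph on the vertex
set `{0, …, n}` that depends only on the information revealed so far: the pairwise distances of the
points `0, …, n`.  (The outputs in the earlier rounds are themselves functions of this data.) -/
def OnlineAlgorithm : Type :=
  (n : ℕ) → (Fin (n + 1) → Fin (n + 1) → ℝ) → SimpleGraph (Fin (n + 1))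

/-- The output of the algorithm `A` after the arrival of the points `x 0, …, x n`. -/
def OnlineAlgorithm.output (A : OnlineAlgorithm) {X : Type*} [MetricSpace X] (x : ℕ → X) (n : ℕ) :
    SimpleGraph (Fin (n + 1)) :=
  A n (fun i j => dist (x i) (x j))

/-- The length of an edge between vertices that are placed in a metric space by `p`. -/
def edgeLength {V X : Type*} [MetricSpace X] (p : V → X) : Sym2 V → ℝ :=
  Sym2.lift ⟨fun u v => dist (p u) (p v), fun u v => dist_comm (p u) (p v)⟩

open Classical in
/-- The cost of a finite graph whose vertices are placed in a metric space by `p`: the sum of the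
lengths of its edges. -/
noncomputable def cost {V X : Type*} [Fintype V] [MetricSpace X] (p : V → X) (G : SimpleGraph V) :
    ℝ :=
  ∑ e ∈ G.edgeFinset, edgeLength p e

/-- The costs of the Steiner trees for the set of terminals `R` in the metric space `X`: the trees
whose vertex set is a finite set of points of `X` that contains `R`. -/
def steinerCosts {X : Type*} [MetricSpace X] (R : Set X) : Set ℝ :=
  {c | ∃ (S : Finset X) (G : SimpleGraph S),
    R ⊆ (S : Set X) ∧ G.IsTree ∧ c = cost (fun s : S => (s : X)) G}

/-- The cost of an optimal Steiner tree for the set of terminals `R`. -/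
noncomputable def steinerOpt {X : Type*} [MetricSpace X] (R : Set X) : ℝ :=
  sInf (steinerCosts R)

theorem cost_nonneg {V X : Type*} [Fintype V] [MetricSpace X] (p : V → X) (G : SimpleGraph V) :
    0 ≤ cost p G := by
  unfold cost
  refine Finset.sum_nonneg fun e _ => ?_
  induction e with
  | _ u v => exact dist_nonneg

/-- The infimum that defines `steinerOpt` is over a set that is bounded below. -/
theorem bddBelow_steinerCosts {X : Type*} [MetricSpace X] (R : Set X) :
    BddBelow (steinerCosts R) := by
  refine ⟨0, ?_⟩
  rintro c ⟨S, G, -, -, rfl⟩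
  exact cost_nonneg _ G

/-- The infimum that defines `steinerOpt` is over a nonempty set. -/
theorem steinerCosts_nonempty {X : Type*} [MetricSpace X] (R : Set X) (hR : R.Finite)
    (hne : R.Nonempty) : (steinerCosts R).Nonempty := by
  obtain ⟨r, hr⟩ := hne
  have : Nonempty hR.toFinset := ⟨⟨r, by simpa using hr⟩⟩
  obtain ⟨G, -, hG⟩ :=
    (SimpleGraph.connected_top (V := hR.toFinset)).exists_isTree_le
  exact ⟨_, hR.toFinset, G, by simp, hG, rfl⟩

/-- The graph on `{0, …, n + 1}` that arises from a graph on `{0, …, n}` when the new vertex `n + 1`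
is joined by an edge to the vertex `j`. -/
def attach {n : ℕ} (T : SimpleGraph (Fin (n + 1))) (j : Fin (n + 1)) :
    SimpleGraph (Fin (n + 2)) :=
  T.map Fin.castSuccEmb ⊔ SimpleGraph.edge j.castSucc (Fin.last (n + 1))

/-- `H` arises from `G` by a single edge swap: one edge `e` of `G` is removed, and one
edge `f` that is not in `G` is added. -/
def IsSwap {V : Type*} (G H : SimpleGraph V) : Prop :=
  ∃ e ∈ G.edgeSet, ∃ f ∉ G.edgeSet, ¬ f.IsDiag ∧ H.edgeSet = (G.edgeSet \ {e}) ∪ {f}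

/-- The change that is allowed upon an arrival: the new vertex is joined by an edge to one of the
previous vertices, and then at most one edge swap is performed. -/
def IsArrivalStep {n : ℕ} (T : SimpleGraph (Fin (n + 1))) (T' : SimpleGraph (Fin (n + 2))) : Prop :=
  ∃ j : Fin (n + 1), T' = attach T j ∨ IsSwap (attach T j) T'

end OnlineSteiner

/-! The algorithm joins each arrival to a nearest earlier point. If some swap keeps the tree a tree
and shortens the exchanged edge by a factor of at least 64, it performs one that removes a longest
possible edge. This rule does not involve `α`. It is shown to be `2 * 6 ^ 10`-competitive, which is
below the required ratio.

Let `κ_n(r)` be the number of clusters of the first points at scale `r` (components of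
`proximityGraph`), and fix scales `b * 64 ^ i`. A short-cut Euler tour of a Steiner tree gives `∑
(κ_n(b * 64 ^ i) - 1) * b * 64 ^ i ≤ 4 * OPT` (`sum_clusters_le_steinerOpt`). It therefore suffices
to bound, for each `l`, the numbers of long tree edges, summed over the levels from `l` on, by a
multiple of the sum of `κ_n - 1` over these levels.

If a tree has at least `κ(r)` edges of length at least `64 * r`, one of them can be swapped for an
edge of length at most `r` (`exists_isTree_swap`). So as long as some level from `l` on has too many
long edges, each arrival triggers a swap that lowers the total long-edge count on these levels by
one (`exists_level_decrease`). Let `s` be the last time without excess. The total at time `n` is at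
most the cluster numbers at time `s`, plus the later far arrivals on each level, minus `n - s`
(`exists_stable_time`).

Clusters of time `s` may have merged by time `n`, but merging needs new points. A packing argument
with truncated distance functions (`clusters_persist`) bounds the clusters of time `s` and the later
far arrivals by the clusters of time `n` at a scale finer by 64, plus a charge to each arrival. Over
all levels an arrival is charged at most 3, against a gain of 15 from its swap, so the term `-(n -
s)` absorbs the charges. -/

/-! ### Component counts and variation along paths -/

section Graph

variable {V : Type*}

theorem reachable_sup_edge_cases {G : SimpleGraph V} {u v a b : V}
    (h : (G ⊔ SimpleGraph.edge u v).Reachable a b) :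
    G.Reachable a b ∨ (G.Reachable a u ∧ G.Reachable v b) ∨
      (G.Reachable a v ∧ G.Reachable u b) := by
  obtain ⟨p⟩ := h
  induction p with
  | nil => exact Or.inl .rfl
  | @cons a c b hac _ ih =>
    rw [SimpleGraph.sup_adj, SimpleGraph.edge_adj] at hac
    rcases hac with hac | ⟨⟨rfl, rfl⟩ | ⟨rfl, rfl⟩, -⟩
    · rcases ih with h | ⟨h, h'⟩ | ⟨h, h'⟩
      · exact Or.inl (hac.reachable.trans h)
      · exact Or.inr (Or.inl ⟨hac.reachable.trans h, h'⟩)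
      · exact Or.inr (Or.inr ⟨hac.reachable.trans h, h'⟩)
    · rcases ih with h | ⟨h, h'⟩ | ⟨h, h'⟩
      · exact Or.inr (Or.inl ⟨.rfl, h⟩)
      · exact Or.inr (Or.inl ⟨.rfl, h'⟩)
      · exact Or.inl h'
    · rcases ih with h | ⟨h, h'⟩ | ⟨h, h'⟩
      · exact Or.inr (Or.inr ⟨.rfl, h⟩)
      · exact Or.inl h'
      · exact Or.inr (Or.inr ⟨.rfl, h'⟩)

/-- The number of connected components of a graph. -/
noncomputable def compCount (G : SimpleGraph V) : ℕ := Nat.card G.ConnectedComponent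

theorem compCount_pos [Finite V] [Nonempty V] (G : SimpleGraph V) : 0 < compCount G :=
  Nat.card_pos

theorem compCount_le_of_surj {W : Type*} [Finite W] {G : SimpleGraph V} (f : W → V)
    (h : ∀ v, ∃ w, G.Reachable (f w) v) : compCount G ≤ Nat.card W := by
  refine Nat.card_le_card_of_surjective (fun w => G.connectedComponentMk (f w)) fun C => ?_
  induction C using SimpleGraph.ConnectedComponent.ind with
  | h v =>
    obtain ⟨w, hw⟩ := h v
    exact ⟨w, SimpleGraph.ConnectedComponent.sound hw⟩

theorem compCount_le_of_reachable [Finite V] {G H : SimpleGraph V}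
    (h : ∀ u v, G.Adj u v → H.Reachable u v) : compCount H ≤ compCount G := by
  have key : ∀ u v, G.Reachable u v → H.Reachable u v := by
    rintro u v ⟨p⟩
    induction p with
    | nil => exact .rfl
    | cons hac _ ih => exact (h _ _ hac).trans ih
  refine Nat.card_le_card_of_surjective
    (SimpleGraph.ConnectedComponent.lift (fun v => H.connectedComponentMk v)
      fun v w p _ => SimpleGraph.ConnectedComponent.sound (key v w ⟨p⟩)) fun C => ?_
  induction C using SimpleGraph.ConnectedComponent.ind with
  | h v => exact ⟨G.connectedComponentMk v, rfl⟩

/-- A new edge merges at most the components of `u` and `v`. Sending the component of `v` to `none`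
makes the map on components injective. -/
theorem compCount_le_sup_edge [Finite V] (G : SimpleGraph V) (u v : V) :
    compCount G ≤ compCount (G ⊔ SimpleGraph.edge u v) + 1 := by
  classical
  unfold compCount
  rw [← Finite.card_option]
  let m : G.ConnectedComponent → (G ⊔ SimpleGraph.edge u v).ConnectedComponent :=
    SimpleGraph.ConnectedComponent.map (SimpleGraph.Hom.ofLE le_sup_left)
  refine Nat.card_le_card_of_injective
    (fun C => if C = G.connectedComponentMk v then none else some (m C)) fun C D hCD => ?_
  by_cases hC : C = G.connectedComponentMk v <;> by_cases hD : D = G.connectedComponentMk v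
  · rw [hC, hD]
  · simp [hC, hD] at hCD
  · simp [hC, hD] at hCD
  · simp only [hC, hD, if_false, Option.some.injEq] at hCD
    induction C using SimpleGraph.ConnectedComponent.ind with
    | h a =>
    induction D using SimpleGraph.ConnectedComponent.ind with
    | h b =>
    have hab := SimpleGraph.ConnectedComponent.exact hCD
    rcases reachable_sup_edge_cases hab with h | ⟨h, h'⟩ | ⟨h, h'⟩
    · exact SimpleGraph.ConnectedComponent.sound h
    · exact absurd (SimpleGraph.ConnectedComponent.sound h'.symm) hD
    · exact absurd (SimpleGraph.ConnectedComponent.sound h) hC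

theorem compCount_sup_edge_lt [Finite V] {G : SimpleGraph V} {u v : V}
    (h : ¬ G.Reachable u v) : compCount (G ⊔ SimpleGraph.edge u v) + 1 ≤ compCount G := by
  have huv : u ≠ v := by rintro rfl; exact h .rfl
  have h1 : compCount (G ⊔ SimpleGraph.edge u v) ≤ compCount G :=
    compCount_le_of_reachable fun a b hab => SimpleGraph.Adj.reachable (Or.inl hab)
  refine lt_of_le_of_ne h1 fun heq => h ?_
  let m : G.ConnectedComponent → (G ⊔ SimpleGraph.edge u v).ConnectedComponent :=
    SimpleGraph.ConnectedComponent.map (SimpleGraph.Hom.ofLE le_sup_left)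
  have hs : Function.Surjective m := SimpleGraph.ConnectedComponent.surjective_map_ofLE _
  have hb : Function.Bijective m :=
    (Nat.bijective_iff_surjective_and_card m).2 ⟨hs, heq.symm⟩
  refine SimpleGraph.ConnectedComponent.exact (hb.1 (SimpleGraph.ConnectedComponent.sound ?_))
  refine SimpleGraph.Adj.reachable (Or.inr ?_)
  rw [SimpleGraph.edge_adj]
  exact ⟨Or.inl ⟨rfl, rfl⟩, huv⟩

theorem fromEdgeSet_insert_eq_sup_edge [Finite V] [DecidableEq V] (E : Finset (Sym2 V)) (u v : V) :
    (SimpleGraph.fromEdgeSet (insert s(u, v) E : Finset (Sym2 V)) : SimpleGraph V) =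
      SimpleGraph.fromEdgeSet E ⊔ SimpleGraph.edge u v := by
  rw [Finset.coe_insert, Set.insert_eq, Set.union_comm, SimpleGraph.fromEdgeSet_union]
  rfl

theorem card_le_card_add_compCount_fromEdgeSet [Finite V] (E : Finset (Sym2 V)) :
    Nat.card V ≤ E.card + compCount (SimpleGraph.fromEdgeSet (E : Set (Sym2 V))) := by
  classical
  induction E using Finset.induction_on with
  | empty =>
    simp only [Finset.card_empty, zero_add, Finset.coe_empty, SimpleGraph.fromEdgeSet_empty]
    refine Nat.card_le_card_of_injective
      (fun v => (⊥ : SimpleGraph V).connectedComponentMk v) fun a b hab => ?_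
    simpa using SimpleGraph.ConnectedComponent.exact hab
  | insert e E he ih =>
    induction e with
    | _ u v =>
    rw [Finset.card_insert_of_notMem he, fromEdgeSet_insert_eq_sup_edge]
    have := compCount_le_sup_edge (SimpleGraph.fromEdgeSet (E : Set (Sym2 V))) u v
    omega

/-- Edges of `G` that join different components are added greedily. Each lowers the component count
by one, so `E` has no more edges than components are lost. -/
theorem exists_spanning_extension [Finite V] (F G : SimpleGraph V) :
    ∃ E : Finset (Sym2 V), (E : Set (Sym2 V)) ⊆ G.edgeSet ∧
      E.card + compCount (F ⊔ SimpleGraph.fromEdgeSet (E : Set (Sym2 V))) ≤ compCount F ∧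
      ∀ u v, G.Adj u v →
        (F ⊔ SimpleGraph.fromEdgeSet (E : Set (Sym2 V))).Reachable u v := by
  classical
  suffices H : ∀ m, ∀ E : Finset (Sym2 V), (E : Set (Sym2 V)) ⊆ G.edgeSet →
      E.card + compCount (F ⊔ SimpleGraph.fromEdgeSet (E : Set (Sym2 V))) ≤ compCount F →
      compCount (F ⊔ SimpleGraph.fromEdgeSet (E : Set (Sym2 V))) ≤ m →
      ∃ E : Finset (Sym2 V), (E : Set (Sym2 V)) ⊆ G.edgeSet ∧
      E.card + compCount (F ⊔ SimpleGraph.fromEdgeSet (E : Set (Sym2 V))) ≤ compCount F ∧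
      ∀ u v, G.Adj u v →
        (F ⊔ SimpleGraph.fromEdgeSet (E : Set (Sym2 V))).Reachable u v from
    H _ ∅ (by simp) (by simp) le_rfl
  intro m
  induction m with
  | zero =>
    intro E hE hc h0
    refine ⟨E, hE, hc, fun u v _ => ?_⟩
    have : Nonempty V := ⟨u⟩
    have := compCount_pos (F ⊔ SimpleGraph.fromEdgeSet (E : Set (Sym2 V)))
    omega
  | succ m ih =>
    intro E hE hc hm
    by_cases hr : ∀ u v, G.Adj u v →
        (F ⊔ SimpleGraph.fromEdgeSet (E : Set (Sym2 V))).Reachable u v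
    · exact ⟨E, hE, hc, hr⟩
    push Not at hr
    obtain ⟨u, v, huv, hn⟩ := hr
    have hlt := compCount_sup_edge_lt hn
    rw [sup_assoc, ← fromEdgeSet_insert_eq_sup_edge] at hlt
    refine ih (insert s(u, v) E) ?_ ?_ (by omega)
    · rw [Finset.coe_insert, Set.insert_subset_iff]
      exact ⟨huv, hE⟩
    · have := Finset.card_insert_le s(u, v) E
      omega

/-- The variation of a real function along an edge. -/
def edgeVariation (f : V → ℝ) : Sym2 V → ℝ :=
  Sym2.lift ⟨fun u v => |f u - f v|, fun u v => abs_sub_comm (f u) (f v)⟩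

theorem edgeVariation_nonneg (f : V → ℝ) (e : Sym2 V) : 0 ≤ edgeVariation f e := by
  induction e with
  | _ u v => exact abs_nonneg _

/-- The triangle inequality along a path; a path repeats no edge, so each edge is paid for once. -/
theorem abs_sub_le_sum_edgeVariation {H : SimpleGraph V} {S : Finset (Sym2 V)} (f : V → ℝ)
    {a b : V} (hab : H.Reachable a b) (hS : H.edgeSet ⊆ S) :
    |f a - f b| ≤ ∑ e ∈ S, edgeVariation f e := by
  classical
  have key : ∀ {a b : V} (p : H.Walk a b), |f a - f b| ≤ (p.edges.map (edgeVariation f)).sum := by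
    intro a b p
    induction p with
    | nil => simp
    | @cons a c b h p ih =>
      simp only [SimpleGraph.Walk.edges_cons, List.map_cons, List.sum_cons]
      have : edgeVariation f s(a, c) = |f a - f c| := rfl
      have := abs_sub_le (f a) (f c) (f b)
      linarith
  obtain ⟨p, hp⟩ := hab.exists_isPath
  refine (key p).trans ?_
  rw [← List.sum_toFinset _ hp.isTrail.edges_nodup]
  refine Finset.sum_le_sum_of_subset_of_nonneg (fun e he => ?_)
    fun e _ _ => edgeVariation_nonneg f e
  exact hS (p.edges_subset_edgeSet (List.mem_toFinset.1 he))

end Graph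

/-! ### Edge exchange in trees -/

section Graph

variable {V : Type*}

theorem connected_of_compCount_le_one [Finite V] [Nonempty V] {G : SimpleGraph V}
    (h : compCount G ≤ 1) : G.Connected := by
  have : Subsingleton G.ConnectedComponent := Finite.card_le_one_iff_subsingleton.1 h
  exact ⟨fun u v => SimpleGraph.ConnectedComponent.exact (Subsingleton.elim _ _)⟩

theorem deleteEdges_sup_edge_eq {G : SimpleGraph V} {a b : V} (h : G.Adj a b) :
    G.deleteEdges {s(a, b)} ⊔ SimpleGraph.edge a b = G := by
  rw [← SimpleGraph.edgeSet_inj, SimpleGraph.edgeSet_sup, SimpleGraph.edgeSet_deleteEdges,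
    SimpleGraph.edgeSet_edge_of_ne h.ne, Set.sdiff_union_self]
  exact Set.union_eq_self_of_subset_right (by simpa using h)

/-- If the graph `S` has fewer components than a tree has after the deletion of the edges in `L`,
then some edge in `L` can be swapped for an edge of `S`. -/
theorem exists_isTree_swap [Fintype V] {T S : SimpleGraph V} (hT : T.IsTree)
    {L : Finset (Sym2 V)} (hL : (L : Set (Sym2 V)) ⊆ T.edgeSet)
    (hdisj : ∀ e ∈ L, e ∉ S.edgeSet) (hcard : compCount S < L.card + 1) :
    ∃ a b u v, s(a, b) ∈ L ∧ S.Adj u v ∧ ¬ T.Adj u v ∧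
      (T.deleteEdges {s(a, b)} ⊔ SimpleGraph.edge u v).IsTree := by
  classical
  have hne : Nonempty V := hT.connected.nonempty
  set F : SimpleGraph V := SimpleGraph.fromEdgeSet ((T.edgeFinset \ L : Finset _) : Set (Sym2 V))
    with hF
  have h1 := card_le_card_add_compCount_fromEdgeSet (T.edgeFinset \ L)
  rw [← hF] at h1
  have hsub : L ⊆ T.edgeFinset := fun e he => SimpleGraph.mem_edgeFinset.2 (hL he)
  rw [Finset.card_sdiff_of_subset hsub] at h1
  have h2 := hT.card_edgeFinset
  have h3 := Finset.card_le_card hsub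
  rw [← Nat.card_eq_fintype_card] at h2
  -- A tree without the edges of `L` has at least `L.card + 1` components, so some edge of `S` joins
  -- two components of `F`.
  have hlt : compCount S < compCount F := by omega
  have hex : ∃ u v, S.Adj u v ∧ ¬ F.Reachable u v := by
    by_contra hcon
    push Not at hcon
    exact absurd (compCount_le_of_reachable hcon) (not_le.2 hlt)
  obtain ⟨u, v, huv, hnr⟩ := hex
  obtain ⟨p, hp⟩ := (hT.connected u v).exists_isPath
  have hpe : ∃ e ∈ p.edges, e ∈ L := by
    by_contra hcon
    push Not at hcon
    refine hnr ⟨p.transfer F fun e he => ?_⟩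
    have heT := p.edges_subset_edgeSet he
    rw [hF, SimpleGraph.edgeSet_fromEdgeSet]
    refine ⟨?_, SimpleGraph.not_isDiag_of_mem_edgeSet T heT⟩
    simp [heT, hcon e he]
  obtain ⟨e, hep, heL⟩ := hpe
  induction e with
  | _ a b =>
  have hab : T.Adj a b := hL heL
  -- Paths in a tree are unique, so a path avoiding `ab` would coincide with `p`, which uses `ab`.
  have hnr' : ¬ (T.deleteEdges {s(a, b)}).Reachable u v := by
    intro hr
    obtain ⟨q, hq⟩ := hr.exists_isPath
    have hle : T.deleteEdges {s(a, b)} ≤ T := SimpleGraph.deleteEdges_le _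
    have heq := (hT.isAcyclic.subsingleton_path u v).elim ⟨p, hp⟩ ⟨q.mapLe hle, hq.mapLe hle⟩
    have heq' : p = q.mapLe hle := congrArg Subtype.val heq
    rw [heq'] at hep
    have hmem : s(a, b) ∈ q.edges := by simpa using hep
    have := q.edges_subset_edgeSet hmem
    simp at this
  refine ⟨a, b, u, v, heL, huv, fun hTuv => ?_, ?_⟩
  · refine hnr (SimpleGraph.Adj.reachable ?_)
    rw [hF, SimpleGraph.fromEdgeSet_adj]
    refine ⟨?_, huv.ne⟩
    have : s(u, v) ∉ L := fun hmem => hdisj _ hmem huv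
    simp [this, hTuv]
  · refine ⟨connected_of_compCount_le_one ?_, ?_⟩
    · have h4 := compCount_sup_edge_lt hnr'
      have h5 := compCount_le_sup_edge (T.deleteEdges {s(a, b)}) a b
      rw [deleteEdges_sup_edge_eq hab] at h5
      have h6 : compCount T ≤ 1 := by
        have := hT.connected.preconnected.subsingleton_connectedComponent
        exact Finite.card_le_one_iff_subsingleton.2 this
      omega
    · exact (hT.isAcyclic.anti (SimpleGraph.deleteEdges_le _)).sup_edge_of_not_reachable hnr'

end Graph

/-! ### Attaching a vertex, swapping, and counting long edges -/

namespace OnlineSteiner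

theorem attach_edgeSet {n : ℕ} (T : SimpleGraph (Fin (n + 1))) (j : Fin (n + 1)) :
    (attach T j).edgeSet =
      insert s(j.castSucc, Fin.last (n + 1)) (Fin.castSuccEmb.sym2Map '' T.edgeSet) := by
  rw [attach, SimpleGraph.edgeSet_sup, SimpleGraph.edgeSet_map,
    SimpleGraph.edgeSet_edge_of_ne (Fin.castSucc_lt_last j).ne, Set.union_comm, Set.insert_eq]

theorem isTree_attach {n : ℕ} {T : SimpleGraph (Fin (n + 1))} (hT : T.IsTree)
    (j : Fin (n + 1)) : (attach T j).IsTree := by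
  rw [SimpleGraph.isTree_iff_connected_and_card] at hT ⊢
  have hmap : ∀ a b, T.Reachable a b → (attach T j).Reachable a.castSucc b.castSucc := by
    intro a b h
    exact (h.map (SimpleGraph.Embedding.map Fin.castSuccEmb T).toHom).mono le_sup_left
  have hlast : (attach T j).Reachable j.castSucc (Fin.last (n + 1)) := by
    refine SimpleGraph.Adj.reachable (Or.inr ?_)
    rw [SimpleGraph.edge_adj]
    exact ⟨Or.inl ⟨rfl, rfl⟩, (Fin.castSucc_lt_last j).ne⟩
  have hj : ∀ v, (attach T j).Reachable j.castSucc v := by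
    intro v
    induction v using Fin.lastCases with
    | last => exact hlast
    | cast v => exact hmap _ _ (hT.1 j v)
  refine ⟨⟨fun u v => (hj u).symm.trans (hj v)⟩, ?_⟩
  rw [attach_edgeSet, Nat.card_coe_set_eq, Set.ncard_insert_of_notMem,
    Set.ncard_image_of_injective _ Fin.castSuccEmb.sym2Map.injective, ← Nat.card_coe_set_eq, hT.2]
  · simp
  · rintro ⟨e, -, he⟩
    induction e with
    | _ a b =>
    have : Fin.last (n + 1) ∈ s(Fin.castSucc a, Fin.castSucc b) := by
      have h' : s(Fin.castSucc a, Fin.castSucc b) = s(j.castSucc, Fin.last (n + 1)) := he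
      rw [h']; simp
    rw [Sym2.mem_iff] at this
    rcases this with h | h
    · exact (Fin.castSucc_lt_last a).ne h.symm
    · exact (Fin.castSucc_lt_last b).ne h.symm

/-- The number of edges of length at least `t`. -/
noncomputable def longCount {V X : Type*} [MetricSpace X] (p : V → X) (G : SimpleGraph V) (t : ℝ) :
    ℕ :=
  {e ∈ G.edgeSet | t ≤ edgeLength p e}.ncard

open Classical in
theorem longCount_attach_le {X : Type*} [MetricSpace X] {n : ℕ} (p : Fin (n + 2) → X)
    (T : SimpleGraph (Fin (n + 1))) (j : Fin (n + 1)) (t : ℝ) :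
    longCount p (attach T j) t ≤ longCount (fun i : Fin (n + 1) => p i.castSucc) T t +
      if t ≤ dist (p (Fin.last (n + 1))) (p j.castSucc) then 1 else 0 := by
  unfold longCount
  rw [attach_edgeSet]
  have himg : {e ∈ Fin.castSuccEmb.sym2Map '' T.edgeSet | t ≤ edgeLength p e} =
      Fin.castSuccEmb.sym2Map ''
        {e ∈ T.edgeSet | t ≤ edgeLength (fun i : Fin (n + 1) => p i.castSucc) e} := by
    ext e
    constructor
    · rintro ⟨⟨e, he, rfl⟩, ht⟩
      refine ⟨e, ⟨he, ?_⟩, rfl⟩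
      induction e with
      | _ a b => exact ht
    · rintro ⟨e, ⟨he, ht⟩, rfl⟩
      refine ⟨⟨e, he, rfl⟩, ?_⟩
      induction e with
      | _ a b => exact ht
  rw [← Set.ncard_image_of_injective _ (Fin.castSuccEmb (n := n + 1)).sym2Map.injective, ← himg]
  have hlen : edgeLength p s(j.castSucc, Fin.last (n + 1)) =
      dist (p (Fin.last (n + 1))) (p j.castSucc) := dist_comm _ _
  split_ifs with h
  · refine (Set.ncard_le_ncard ?_ (Set.toFinite _)).trans
      (Set.ncard_insert_le s(j.castSucc, Fin.last (n + 1)) _)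
    rintro e ⟨he | he, ht⟩
    · exact Or.inl he
    · exact Or.inr ⟨he, ht⟩
  · refine Set.ncard_le_ncard ?_ (Set.toFinite _)
    rintro e ⟨rfl | he, ht⟩
    · exact absurd (hlen ▸ ht) h
    · exact ⟨he, ht⟩

theorem swap_edgeSet {V : Type*} (G : SimpleGraph V) {a b u v : V} (huv : u ≠ v) :
    (G.deleteEdges {s(a, b)} ⊔ SimpleGraph.edge u v).edgeSet =
      (G.edgeSet \ {s(a, b)}) ∪ {s(u, v)} := by
  rw [SimpleGraph.edgeSet_sup, SimpleGraph.edgeSet_deleteEdges,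
    SimpleGraph.edgeSet_edge_of_ne huv]

theorem isSwap_swap {V : Type*} {G : SimpleGraph V} {a b u v : V} (hab : G.Adj a b) (huv : u ≠ v)
    (hn : ¬ G.Adj u v) : IsSwap G (G.deleteEdges {s(a, b)} ⊔ SimpleGraph.edge u v) :=
  ⟨s(a, b), hab, s(u, v), hn, by simpa using huv, swap_edgeSet G huv⟩

theorem longCount_swap_le {V X : Type*} [Finite V] [MetricSpace X] (p : V → X)
    {G : SimpleGraph V} {a b u v : V} (hab : G.Adj a b) (huv : u ≠ v)
    (hlen : dist (p u) (p v) ≤ dist (p a) (p b)) (t : ℝ) :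
    longCount p (G.deleteEdges {s(a, b)} ⊔ SimpleGraph.edge u v) t ≤ longCount p G t := by
  unfold longCount
  rw [swap_edgeSet G huv]
  by_cases ht : t ≤ dist (p u) (p v)
  · have h1 : {e ∈ (G.edgeSet \ {s(a, b)}) ∪ {s(u, v)} | t ≤ edgeLength p e} ⊆
        insert s(u, v) ({e ∈ G.edgeSet | t ≤ edgeLength p e} \ {s(a, b)}) := by
      rintro e ⟨⟨he, hne⟩ | he, hte⟩
      · exact Or.inr ⟨⟨he, hte⟩, hne⟩
      · exact Or.inl he
    refine (Set.ncard_le_ncard h1 (Set.toFinite _)).trans ((Set.ncard_insert_le _ _).trans ?_)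
    exact (Set.ncard_sdiff_singleton_add_one
      (show s(a, b) ∈ {e ∈ G.edgeSet | t ≤ edgeLength p e} from ⟨hab, ht.trans hlen⟩)
      (Set.toFinite _)).le
  · refine Set.ncard_le_ncard ?_ (Set.toFinite _)
    rintro e ⟨⟨he, -⟩ | rfl, hte⟩
    · exact ⟨he, hte⟩
    · exact absurd hte ht

theorem longCount_swap_lt {V X : Type*} [Finite V] [MetricSpace X] (p : V → X)
    {G : SimpleGraph V} {a b u v : V} (hab : G.Adj a b) (huv : u ≠ v) {t : ℝ}
    (h1 : dist (p u) (p v) < t) (h2 : t ≤ dist (p a) (p b)) :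
    longCount p (G.deleteEdges {s(a, b)} ⊔ SimpleGraph.edge u v) t + 1 ≤ longCount p G t := by
  unfold longCount
  rw [swap_edgeSet G huv, ← Set.ncard_sdiff_singleton_add_one
    (show s(a, b) ∈ {e ∈ G.edgeSet | t ≤ edgeLength p e} from ⟨hab, h2⟩) (Set.toFinite _)]
  refine Nat.add_le_add_right (Set.ncard_le_ncard ?_ (Set.toFinite _)) 1
  rintro e ⟨⟨he, hne⟩ | rfl, hte⟩
  · exact ⟨⟨he, hte⟩, hne⟩
  · exact absurd hte (not_le.2 h1)

/-! ### Packing: persistence of clusters -/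

section Packing

variable {X : Type*} [MetricSpace X]

/-- The distance to a set, truncated at `R`. -/
noncomputable def truncDist (R : ℝ) (c : Set X) (y : X) : ℝ := min (Metric.infDist y c) R

theorem abs_truncDist_sub_le_dist (R : ℝ) (c : Set X) (y z : X) :
    |truncDist R c y - truncDist R c z| ≤ dist y z := by
  refine (abs_min_sub_min_le_max _ _ _ _).trans ?_
  rw [sub_self, abs_zero]
  refine max_le ?_ dist_nonneg
  rw [abs_sub_le_iff]
  have h1 := Metric.infDist_le_infDist_add_dist (s := c) (x := y) (y := z)
  have h2 := Metric.infDist_le_infDist_add_dist (s := c) (x := z) (y := y)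
  rw [dist_comm z y] at h2
  constructor <;> linarith

theorem abs_truncDist_sub_le {R : ℝ} (hR : 0 ≤ R) (c : Set X) (y z : X) :
    |truncDist R c y - truncDist R c z| ≤ R := by
  have h1 : ∀ y, 0 ≤ truncDist R c y := fun y => le_min Metric.infDist_nonneg hR
  have h2 : ∀ y, truncDist R c y ≤ R := fun y => min_le_right _ _
  rw [abs_sub_le_iff]
  constructor <;> linarith [h1 y, h1 z, h2 y, h2 z]

/-- The `ρ / 2`-neighbourhoods of the sets are disjoint, so `y` and `z` each lie in at most one of
them. All functions whose neighbourhood contains neither point equal `ρ / 2` at both. -/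
theorem sum_abs_truncDist_sub_le {ι : Type*} [Fintype ι] {c : ι → Set X}
    (hne : ∀ i, (c i).Nonempty) {ρ : ℝ} (hρ : 0 ≤ ρ)
    (hsep : ∀ i j, i ≠ j → ∀ a ∈ c i, ∀ b ∈ c j, ρ ≤ dist a b) (y z : X) :
    ∑ i, |truncDist (ρ / 2) (c i) y - truncDist (ρ / 2) (c i) z| ≤
      2 * min (dist y z) (ρ / 2) := by
  classical
  set m := min (dist y z) (ρ / 2) with hm
  have hm0 : 0 ≤ m := le_min dist_nonneg (by linarith)
  have key : ∀ w : X, ∑ i, (if Metric.infDist w (c i) < ρ / 2 then m else 0) ≤ m := by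
    intro w
    rw [← Finset.sum_filter, Finset.sum_const, nsmul_eq_mul]
    have hcard : (Finset.univ.filter fun i => Metric.infDist w (c i) < ρ / 2).card ≤ 1 := by
      rw [Finset.card_le_one]
      intro i hi j hj
      by_contra hij
      obtain ⟨a, ha, hwa⟩ := (Metric.infDist_lt_iff (hne i)).1 (Finset.mem_filter.1 hi).2
      obtain ⟨b, hb, hwb⟩ := (Metric.infDist_lt_iff (hne j)).1 (Finset.mem_filter.1 hj).2
      have := hsep i j hij a ha b hb
      have := dist_triangle_left a b w
      linarith
    have : ((Finset.univ.filter fun i => Metric.infDist w (c i) < ρ / 2).card : ℝ) ≤ 1 := by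
      exact_mod_cast hcard
    nlinarith
  have hterm : ∀ i, |truncDist (ρ / 2) (c i) y - truncDist (ρ / 2) (c i) z| ≤
      (if Metric.infDist y (c i) < ρ / 2 then m else 0) +
      (if Metric.infDist z (c i) < ρ / 2 then m else 0) := by
    intro i
    have hle : |truncDist (ρ / 2) (c i) y - truncDist (ρ / 2) (c i) z| ≤ m :=
      le_min (abs_truncDist_sub_le_dist _ _ _ _) (abs_truncDist_sub_le (by linarith) _ _ _)
    split_ifs with h1 h2 h2
    · linarith
    · linarith
    · linarith
    · rw [truncDist, truncDist, min_eq_right (not_lt.1 h1), min_eq_right (not_lt.1 h2)]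
      simp
  refine (Finset.sum_le_sum fun i _ => hterm i).trans ?_
  rw [Finset.sum_add_distrib]
  linarith [key y, key z]

/-- The graph on `{0, …, n}` that joins two indices if their points have distance at most `r`. -/
def proximityGraph (x : ℕ → X) (n : ℕ) (r : ℝ) : SimpleGraph (Fin (n + 1)) where
  Adj u v := u ≠ v ∧ dist (x u) (x v) ≤ r
  symm := ⟨fun u v h => ⟨h.1.symm, by rw [dist_comm]; exact h.2⟩⟩
  loopless := ⟨fun u h => h.1 rfl⟩

theorem sum_union_le_of_nonneg {α : Type*} [DecidableEq α] {f : α → ℝ} (hf : ∀ a, 0 ≤ f a)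
    (s t : Finset α) : ∑ a ∈ s ∪ t, f a ≤ ∑ a ∈ s, f a + ∑ a ∈ t, f a := by
  rw [← Finset.sum_union_inter]
  exact le_add_of_nonneg_right (Finset.sum_nonneg fun a _ => hf a)

/-- Among sets of points that are pairwise at distance at least `ρ`, every connected graph that
meets at least two of them pays `ρ / 2` for each. -/
theorem card_mul_le_sum_of_connected {V ι : Type*} [Fintype ι] [Nontrivial ι]
    {c : ι → Set X} {ρ : ℝ} (hρ : 0 ≤ ρ)
    (hsep : ∀ i j, i ≠ j → ∀ a ∈ c i, ∀ b ∈ c j, ρ ≤ dist a b)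
    (p : V → X) (hV : ∀ i, ∃ v, p v ∈ c i) {H : SimpleGraph V} (hH : ∀ u v, H.Reachable u v)
    {S : Finset (Sym2 V)} (hS : H.edgeSet ⊆ S) :
    (Fintype.card ι : ℝ) * (ρ / 2) ≤
      ∑ e ∈ S, ∑ i, edgeVariation (fun v => truncDist (ρ / 2) (c i) (p v)) e := by
  rw [Finset.sum_comm]
  have : (Fintype.card ι : ℝ) * (ρ / 2) = ∑ _i : ι, ρ / 2 := by simp
  rw [this]
  refine Finset.sum_le_sum fun i _ => ?_
  -- The `i`-th function vanishes on `c i` and equals `ρ / 2` on any other set, so it varies by `ρ /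
  -- 2` along a connection between the two.
  obtain ⟨j, hij⟩ := exists_ne i
  obtain ⟨u, hu⟩ := hV i
  obtain ⟨v, hv⟩ := hV j
  refine le_trans ?_ (abs_sub_le_sum_edgeVariation
    (fun v => truncDist (ρ / 2) (c i) (p v)) (hH v u) hS)
  have h1 : truncDist (ρ / 2) (c i) (p u) = 0 := by
    rw [truncDist, Metric.infDist_zero_of_mem hu, min_eq_left (by linarith)]
  have h2 : truncDist (ρ / 2) (c i) (p v) = ρ / 2 := by
    refine min_eq_right ((Metric.le_infDist ⟨_, hu⟩).2 fun b hb => ?_)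
    have := hsep j i hij _ hv b hb
    linarith
  simp only [h1, h2, sub_zero]
  exact le_abs_self _

/-- The short nearest-neighbour edges of the points `s + 1, …, n`, added to a graph on the
points `0, …, s`, leave few components. -/
theorem exists_greedy_edges (x : ℕ → X) {s n : ℕ} (hsn : s + 1 ≤ n + 1) {par : ℕ → ℕ}
    (hpar : ∀ v, 0 < v → par v < v) (r : ℝ) (A : SimpleGraph (Fin (s + 1))) :
    ∃ Gr : Finset (Sym2 (Fin (n + 1))),
      compCount (A.map (Fin.castLEEmb hsn) ⊔ SimpleGraph.fromEdgeSet (Gr : Set _)) ≤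
        compCount A + ((Finset.Ioc s n).filter fun v => r < dist (x v) (x (par v))).card ∧
      ∀ W : Sym2 (Fin (n + 1)) → ℝ, (∀ e, 0 ≤ W e) →
        (∀ u v, W s(u, v) ≤ 2 * dist (x u) (x v)) →
        ∑ e ∈ Gr, W e ≤ 2 * ∑ v ∈ (Finset.Ioc s n).filter (fun v => dist (x v) (x (par v)) ≤ r),
          dist (x v) (x (par v)) := by
  classical
  set δ : ℕ → ℝ := fun v => dist (x v) (x (par v)) with hδ
  set Q := (Finset.Ioc s n).filter fun v => r < δ v with hQ
  let emb : Fin (s + 1) ↪ Fin (n + 1) := Fin.castLEEmb hsn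
  have hparle : ∀ v, 0 < v → v < n + 1 → par v < n + 1 := fun v h0 hv => (hpar v h0).trans hv
  let par' : Fin (n + 1) → Fin (n + 1) := fun v =>
    if h : 0 < (v : ℕ) then ⟨par v, hparle v h v.2⟩ else v
  let J : Finset (Fin (n + 1)) := Finset.univ.filter fun v => s < (v : ℕ) ∧ δ v ≤ r
  let Gr : Finset (Sym2 (Fin (n + 1))) := J.image fun v => s(v, par' v)
  let F : SimpleGraph (Fin (n + 1)) := A.map emb ⊔ SimpleGraph.fromEdgeSet (Gr : Set _)
  have hparval : ∀ v : Fin (n + 1), 0 < (v : ℕ) → ((par' v : Fin (n + 1)) : ℕ) = par v :=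
    fun v h => by simp only [par', dif_pos h]
  refine ⟨Gr, ?_, fun W hW0 hWle => ?_⟩
  · have : Fintype A.ConnectedComponent := Fintype.ofFinite _
    change compCount F ≤ compCount A + Q.card
    have : Nat.card (A.ConnectedComponent ⊕ {v // v ∈ Q}) = compCount A + Q.card := by
      rw [Nat.card_sum, compCount, Nat.card_eq_fintype_card (α := {v // v ∈ Q}), Fintype.card_coe]
    rw [← this]
    -- Representatives of the components: one vertex for each component of `A`, and each late
    -- arrival too far from its predecessor. Any other late vertex is traced back through its
    -- predecessors.
    let f : A.ConnectedComponent ⊕ {v // v ∈ Q} → Fin (n + 1) := Sum.elim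
      (fun C => emb C.out)
      (fun v => ⟨v, Nat.lt_succ_of_le (Finset.mem_Ioc.1 (Finset.mem_filter.1 v.2).1).2⟩)
    refine compCount_le_of_surj f ?_
    suffices H : ∀ m (hm : m < n + 1), ∃ w, F.Reachable (f w) ⟨m, hm⟩ from fun v => H v v.2
    intro m
    induction m using Nat.strong_induction_on with
    | _ m ih =>
    intro hm
    by_cases hms : m ≤ s
    · refine ⟨Sum.inl (A.connectedComponentMk ⟨m, by omega⟩), ?_⟩
      have hr : A.Reachable (A.connectedComponentMk ⟨m, by omega⟩).out ⟨m, by omega⟩ :=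
        SimpleGraph.ConnectedComponent.exact (Quot.out_eq _)
      exact (hr.map (SimpleGraph.Embedding.map emb A).toHom).mono le_sup_left
    · push Not at hms
      by_cases hmr : δ m ≤ r
      · have h0 : 0 < m := by omega
        obtain ⟨w, hw⟩ := ih (par m) (hpar m h0) (hparle m h0 hm)
        refine ⟨w, hw.trans (SimpleGraph.Adj.reachable (Or.inr ?_))⟩
        rw [SimpleGraph.fromEdgeSet_adj]
        refine ⟨Finset.mem_coe.2 (Finset.mem_image.2 ⟨⟨m, hm⟩, ?_, ?_⟩), ?_⟩
        · exact Finset.mem_filter.2 ⟨Finset.mem_univ _, hms, hmr⟩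
        · rw [Sym2.eq_swap]
          exact congrArg (fun w => s(w, _)) (Fin.ext (hparval ⟨m, hm⟩ h0))
        · have := hpar m h0
          simp only [ne_eq, Fin.mk.injEq]
          omega
      · have hmQ : m ∈ Q := Finset.mem_filter.2
          ⟨Finset.mem_Ioc.2 ⟨hms, Nat.lt_succ_iff.1 hm⟩, not_le.1 hmr⟩
        exact ⟨Sum.inr ⟨m, hmQ⟩, .rfl⟩
  · have h1 : ∑ e ∈ Gr, W e ≤ ∑ v ∈ J, W s(v, par' v) :=
      Finset.sum_image_le_of_nonneg fun e _ => hW0 e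
    refine h1.trans ?_
    rw [Finset.mul_sum]
    have h2 : (Finset.Ioc s n).filter (fun v => δ v ≤ r) = J.map Fin.valEmbedding := by
      ext v
      simp only [J, Finset.mem_filter, Finset.mem_Ioc, Finset.mem_map, Finset.mem_univ, true_and,
        Fin.valEmbedding_apply]
      constructor
      · rintro ⟨⟨h, h'⟩, h''⟩
        exact ⟨⟨v, by omega⟩, ⟨h, h''⟩, rfl⟩
      · rintro ⟨w, ⟨h, h'⟩, rfl⟩
        exact ⟨⟨h, Nat.lt_succ_iff.1 w.2⟩, h'⟩
    rw [h2, Finset.sum_map]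
    refine Finset.sum_le_sum fun v hv => ?_
    have hv0 : 0 < (v : ℕ) := by
      have := (Finset.mem_filter.1 hv).2.1
      omega
    have := hWle v (par' v)
    rwa [hparval v hv0] at this

/-- The number of clusters at a coarse scale `ρ` at time `s`, together with the number of later
points that arrive at distance more than `ρ` from their predecessors, is bounded in terms of the
number of clusters at a finer scale `r` at time `n` and the arrivals in between. -/
theorem clusters_persist (x : ℕ → X) {s n : ℕ} (hsn : s ≤ n) {par : ℕ → ℕ}
    (hpar : ∀ v, 0 < v → par v < v)
    (hnear : ∀ v, ∀ i < v, dist (x v) (x (par v)) ≤ dist (x v) (x i))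
    {r ρ : ℝ} (hr : 0 < r) (hrρ : r ≤ ρ) :
    ((compCount (proximityGraph x s ρ) : ℝ) - 1 +
        ((Finset.Ioc s n).filter fun v => ρ < dist (x v) (x (par v))).card) * (ρ / 2) ≤
      2 * ∑ v ∈ (Finset.Ioc s n).filter (fun v => dist (x v) (x (par v)) ≤ r),
        dist (x v) (x (par v)) +
      2 * r * ((compCount (proximityGraph x s ρ) : ℝ) - 1 +
        ((Finset.Ioc s n).filter fun v => r < dist (x v) (x (par v))).card) +
      ρ * ((compCount (proximityGraph x n r) : ℝ) - 1) := by
  classical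
  have hρ : 0 < ρ := hr.trans_le hrρ
  set δ : ℕ → ℝ := fun v => dist (x v) (x (par v)) with hδ
  have hδ0 : ∀ v, 0 ≤ δ v := fun v => dist_nonneg
  set P := (Finset.Ioc s n).filter fun v => ρ < δ v with hP
  set Q := (Finset.Ioc s n).filter fun v => r < δ v with hQ
  set A := proximityGraph x s ρ with hA
  have hκA : (1 : ℝ) ≤ compCount A := by exact_mod_cast compCount_pos A
  have hκn : (1 : ℝ) ≤ compCount (proximityGraph x n r) := by
    exact_mod_cast compCount_pos (proximityGraph x n r)
  have : Fintype A.ConnectedComponent := Fintype.ofFinite _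
  set ι := A.ConnectedComponent ⊕ {v // v ∈ P} with hι
  have hcardι : (Fintype.card ι : ℝ) = compCount A + P.card := by
    rw [Fintype.card_sum, Fintype.card_coe, compCount, Nat.card_eq_fintype_card]
    push_cast; rfl
  -- The packing bound needs two sets; with at most one, the left side is not positive.
  rcases le_or_gt (Fintype.card ι) 1 with hsmall | hbig
  · have h1 : (Fintype.card ι : ℝ) ≤ 1 := by exact_mod_cast hsmall
    have h2 : ((compCount A : ℝ) - 1 + P.card) * (ρ / 2) ≤ 0 :=
      mul_nonpos_of_nonpos_of_nonneg (by linarith) (by linarith)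
    have h3 : 0 ≤ ∑ v ∈ (Finset.Ioc s n).filter (fun v => δ v ≤ r), δ v :=
      Finset.sum_nonneg fun v _ => hδ0 v
    have h4 : 0 ≤ 2 * r * ((compCount A : ℝ) - 1 + Q.card) := by
      have : (0 : ℝ) ≤ Q.card := Nat.cast_nonneg _
      have : 0 ≤ (compCount A : ℝ) - 1 + Q.card := by linarith
      positivity
    have h5 : 0 ≤ ρ * ((compCount (proximityGraph x n r) : ℝ) - 1) :=
      mul_nonneg hρ.le (by linarith)
    linarith
  have : Nontrivial ι := Fintype.one_lt_card_iff_nontrivial.1 hbig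
  -- The separated sets: the clusters of time `s`, and one singleton for each later arrival at
  -- distance more than `ρ` from all earlier points.
  let c : ι → Set X := Sum.elim
    (fun C => {y | ∃ u : Fin (s + 1), A.connectedComponentMk u = C ∧ x u = y}) (fun v => {x v})
  let emb : Fin (s + 1) ↪ Fin (n + 1) := Fin.castLEEmb (by omega)
  let p : Fin (n + 1) → X := fun v => x v
  have hne : ∀ i, ∃ v, p v ∈ c i := by
    rintro (C | ⟨v, hv⟩)
    · induction C using SimpleGraph.ConnectedComponent.ind with
      | h u => exact ⟨emb u, u, rfl, rfl⟩
    · have := (Finset.mem_Ioc.1 (Finset.mem_filter.1 hv).1).2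
      exact ⟨⟨v, by omega⟩, rfl⟩
  have hbigsep : ∀ v ∈ P, ∀ i < v, ρ ≤ dist (x v) (x i) := fun v hv i hi =>
    (Finset.mem_filter.1 hv).2.le.trans (hnear v i hi)
  have hsep : ∀ i j, i ≠ j → ∀ a ∈ c i, ∀ b ∈ c j, ρ ≤ dist a b := by
    rintro (C | ⟨v, hv⟩) (D | ⟨w, hw⟩) hij a ha b hb
    · obtain ⟨u, hu, rfl⟩ := ha
      obtain ⟨u', hu', rfl⟩ := hb
      by_contra hlt
      refine hij (congrArg Sum.inl ?_)
      rw [← hu, ← hu']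
      by_cases huu : u = u'
      · rw [huu]
      · exact SimpleGraph.ConnectedComponent.sound
          (SimpleGraph.Adj.reachable ⟨huu, (not_le.1 hlt).le⟩)
    · obtain ⟨u, hu, rfl⟩ := ha
      obtain rfl : b = x w := hb
      rw [dist_comm]
      have := (Finset.mem_Ioc.1 (Finset.mem_filter.1 hw).1).1
      exact hbigsep w hw u (by omega)
    · obtain ⟨u, hu, rfl⟩ := hb
      obtain rfl : a = x v := ha
      have := (Finset.mem_Ioc.1 (Finset.mem_filter.1 hv).1).1
      exact hbigsep v hv u (by omega)
    · obtain rfl : a = x v := ha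
      obtain rfl : b = x w := hb
      rcases lt_trichotomy v w with h | h | h
      · rw [dist_comm]; exact hbigsep w hw v h
      · subst h; exact absurd rfl hij
      · exact hbigsep v hv w h
  obtain ⟨Gr, hκF, hGrW⟩ := exists_greedy_edges x (by omega : s + 1 ≤ n + 1) hpar r A
  set F : SimpleGraph (Fin (n + 1)) :=
    A.map (Fin.castLEEmb (by omega : s + 1 ≤ n + 1)) ⊔ SimpleGraph.fromEdgeSet (Gr : Set _) with hF
  -- The connected graph for the packing bound has four kinds of edges: old edges inside clusters
  -- (free), short greedy edges, edges of length at most `r` (`E1`), and arbitrary edges completing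
  -- the connection (`E2`), fewer than the clusters of time `n`.
  obtain ⟨E1, hE1, hc1, hr1⟩ := exists_spanning_extension F (proximityGraph x n r)
  set H1 := F ⊔ SimpleGraph.fromEdgeSet (E1 : Set (Sym2 (Fin (n + 1)))) with hH1
  obtain ⟨E2, hE2, hc2, hr2⟩ := exists_spanning_extension H1 ⊤
  set H2 := H1 ⊔ SimpleGraph.fromEdgeSet (E2 : Set (Sym2 (Fin (n + 1)))) with hH2
  have hreach : ∀ u v, H2.Reachable u v := fun u v => by
    by_cases huv : u = v
    · rw [huv]
    · exact hr2 u v huv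
  let O : Finset (Sym2 (Fin (n + 1))) := (A.map emb).edgeSet.toFinset
  have hS : H2.edgeSet ⊆ ((((O ∪ Gr) ∪ E1) ∪ E2 : Finset _) : Set (Sym2 (Fin (n + 1)))) := by
    have hfe : ∀ E : Finset (Sym2 (Fin (n + 1))),
        (SimpleGraph.fromEdgeSet (E : Set (Sym2 (Fin (n + 1))))).edgeSet ⊆ E := fun E => by
      rw [SimpleGraph.edgeSet_fromEdgeSet]; exact Set.sdiff_subset
    rw [hH2, hH1, SimpleGraph.edgeSet_sup, SimpleGraph.edgeSet_sup, SimpleGraph.edgeSet_sup]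
    push_cast
    refine Set.union_subset_union (Set.union_subset_union (Set.union_subset_union ?_ ?_) ?_) ?_
    · exact (Set.coe_toFinset (A.map emb).edgeSet).ge
    · exact hfe Gr
    · exact hfe E1
    · exact hfe E2
  have hmain := card_mul_le_sum_of_connected hρ.le hsep p hne hreach hS
  rw [hcardι] at hmain
  set W : Sym2 (Fin (n + 1)) → ℝ := fun e =>
    ∑ i, edgeVariation (fun v => truncDist (ρ / 2) (c i) (p v)) e with hW
  have hW0 : ∀ e, 0 ≤ W e := fun e => Finset.sum_nonneg fun i _ => edgeVariation_nonneg _ _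
  have hWle : ∀ u v, W s(u, v) ≤ 2 * min (dist (p u) (p v)) (ρ / 2) := fun u v =>
    sum_abs_truncDist_sub_le (c := c) (fun i => ⟨_, (hne i).choose_spec⟩) hρ.le hsep (p u) (p v)
  have hsum : ∑ e ∈ ((O ∪ Gr) ∪ E1) ∪ E2, W e ≤
      ∑ e ∈ O, W e + ∑ e ∈ Gr, W e + ∑ e ∈ E1, W e + ∑ e ∈ E2, W e := by
    have h1 := sum_union_le_of_nonneg hW0 ((O ∪ Gr) ∪ E1) E2
    have h2 := sum_union_le_of_nonneg hW0 (O ∪ Gr) E1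
    have h3 := sum_union_le_of_nonneg hW0 O Gr
    linarith
  -- Both ends lie in one cluster: its own function vanishes at both, and every other function is
  -- truncated to `ρ / 2` at both.
  have hO : ∑ e ∈ O, W e = 0 := by
    refine Finset.sum_eq_zero fun e he => ?_
    have he' : e ∈ (A.map emb).edgeSet := Set.mem_toFinset.1 he
    rw [SimpleGraph.edgeSet_map] at he'
    obtain ⟨e, heA, rfl⟩ := he'
    induction e with
    | _ a b =>
    have hab : A.Adj a b := heA
    have hC : A.connectedComponentMk a = A.connectedComponentMk b :=
      SimpleGraph.ConnectedComponent.sound hab.reachable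
    refine Finset.sum_eq_zero fun i _ => ?_
    change |truncDist (ρ / 2) (c i) (x a) - truncDist (ρ / 2) (c i) (x b)| = 0
    by_cases hi : i = Sum.inl (A.connectedComponentMk a)
    · have h1 : x a ∈ c i := by rw [hi]; exact ⟨a, rfl, rfl⟩
      have h2 : x b ∈ c i := by rw [hi]; exact ⟨b, hC.symm, rfl⟩
      rw [truncDist, truncDist, Metric.infDist_zero_of_mem h1, Metric.infDist_zero_of_mem h2]
      simp
    · have hfar : ∀ u : Fin (s + 1), A.connectedComponentMk u = A.connectedComponentMk a →
          truncDist (ρ / 2) (c i) (x u) = ρ / 2 := fun u hu => by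
        refine min_eq_right ((Metric.le_infDist ⟨_, (hne i).choose_spec⟩).2 fun y hy => ?_)
        have := hsep (Sum.inl (A.connectedComponentMk a)) i (Ne.symm hi) (x u) ⟨u, hu, rfl⟩ y hy
        linarith
      rw [hfar a rfl, hfar b hC.symm]
      simp
  have hGr : ∑ e ∈ Gr, W e ≤ 2 * ∑ v ∈ (Finset.Ioc s n).filter (fun v => δ v ≤ r), δ v :=
    hGrW W hW0 fun u v => by linarith [hWle u v, min_le_left (dist (p u) (p v)) (ρ / 2)]
  have hsE1 : ∑ e ∈ E1, W e ≤ E1.card * (2 * r) := by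
    rw [← nsmul_eq_mul]
    refine Finset.sum_le_card_nsmul _ _ _ fun e he => ?_
    have he' := hE1 he
    induction e with
    | _ u v =>
    have h1 := hWle u v
    have h2 : dist (p u) (p v) ≤ r := he'.2
    linarith [min_le_left (dist (p u) (p v)) (ρ / 2)]
  have hsE2 : ∑ e ∈ E2, W e ≤ E2.card * ρ := by
    rw [← nsmul_eq_mul]
    refine Finset.sum_le_card_nsmul _ _ _ fun e he => ?_
    induction e with
    | _ u v => linarith [hWle u v, min_le_right (dist (p u) (p v)) (ρ / 2)]
  have hκ1 : compCount H1 ≤ compCount (proximityGraph x n r) := compCount_le_of_reachable hr1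
  have hp1 := compCount_pos H1
  have hp2 := compCount_pos H2
  have hE1c : (E1.card : ℝ) ≤ (compCount A : ℝ) - 1 + Q.card := by
    have : E1.card + 1 ≤ compCount A + Q.card := by
      have : compCount F ≤ compCount A + Q.card := hκF
      omega
    have : (E1.card : ℝ) + 1 ≤ compCount A + Q.card := by exact_mod_cast this
    linarith
  have hE2c : (E2.card : ℝ) ≤ (compCount (proximityGraph x n r) : ℝ) - 1 := by
    have : E2.card + 1 ≤ compCount (proximityGraph x n r) := by omega
    have : (E2.card : ℝ) + 1 ≤ compCount (proximityGraph x n r) := by exact_mod_cast this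
    linarith
  have hb1 := mul_le_mul_of_nonneg_right hE1c (by positivity : 0 ≤ 2 * r)
  have hb2 := mul_le_mul_of_nonneg_right hE2c hρ.le
  have : ((compCount A : ℝ) - 1 + P.card) * (ρ / 2) ≤ ((compCount A : ℝ) + P.card) * (ρ / 2) := by
    nlinarith
  linarith

end Packing

/-! ### The greedy algorithm and the decrease of long edges -/

section Algorithm

/-- The graph that arises from `G` when the edge `ab` is swapped for the edge `uv`. -/
def swapEdge {V : Type*} (G : SimpleGraph V) (a b u v : V) : SimpleGraph V :=
  G.deleteEdges {s(a, b)} ⊔ SimpleGraph.edge u v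

/-- Swapping `ab` for `uv` turns `G` into a tree, and `uv` is shorter by a factor of `64`. -/
def IsImproving {V : Type*} (D : V → V → ℝ) (G : SimpleGraph V) (a b u v : V) : Prop :=
  G.Adj a b ∧ ¬ G.Adj u v ∧ u ≠ v ∧ 0 < D a b ∧ 64 * D u v ≤ D a b ∧ (swapEdge G a b u v).IsTree

/-- The rule of the greedy algorithm: attach the new vertex to a nearest one, then perform an
improving swap that removes an edge of the largest possible length, if there is an improving
swap. -/
def IsGreedyStep {n : ℕ} (D : Fin (n + 2) → Fin (n + 2) → ℝ) (T : SimpleGraph (Fin (n + 1)))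
    (T' : SimpleGraph (Fin (n + 2))) : Prop :=
  ∃ j : Fin (n + 1), (∀ i : Fin (n + 1), D (Fin.last _) j.castSucc ≤ D (Fin.last _) i.castSucc) ∧
    ((T' = attach T j ∧ ∀ a b u v, ¬ IsImproving D (attach T j) a b u v) ∨
      ∃ a b u v, IsImproving D (attach T j) a b u v ∧ T' = swapEdge (attach T j) a b u v ∧
        ∀ a' b' u' v', IsImproving D (attach T j) a' b' u' v' → D a' b' ≤ D a b)

theorem exists_isGreedyStep {n : ℕ} (D : Fin (n + 2) → Fin (n + 2) → ℝ)
    (T : SimpleGraph (Fin (n + 1))) : ∃ T', IsGreedyStep D T T' := by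
  obtain ⟨j, hj⟩ := Finite.exists_min fun i : Fin (n + 1) => D (Fin.last _) i.castSucc
  by_cases h : ∃ a b u v, IsImproving D (attach T j) a b u v
  · obtain ⟨a, b, u, v, h⟩ := h
    let I := {q : Fin (n + 2) × Fin (n + 2) × Fin (n + 2) × Fin (n + 2) //
      IsImproving D (attach T j) q.1 q.2.1 q.2.2.1 q.2.2.2}
    have : Nonempty I := ⟨⟨(a, b, u, v), h⟩⟩
    obtain ⟨⟨⟨a, b, u, v⟩, hq⟩, hmax⟩ := Finite.exists_max fun q : I => D q.1.1 q.1.2.1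
    exact ⟨_, j, hj, Or.inr ⟨a, b, u, v, hq, rfl,
      fun a' b' u' v' h' => hmax ⟨(a', b', u', v'), h'⟩⟩⟩
  · push Not at h
    exact ⟨_, j, hj, Or.inl ⟨rfl, h⟩⟩

/-- The greedy algorithm. -/
noncomputable def greedyAlgorithm : OnlineAlgorithm
  | 0, _ => ⊥
  | n + 1, D =>
    (exists_isGreedyStep D (greedyAlgorithm n fun i j => D i.castSucc j.castSucc)).choose

variable {X : Type*} [MetricSpace X]

theorem isGreedyStep_output (x : ℕ → X) (n : ℕ) :
    IsGreedyStep (fun i j : Fin (n + 2) => dist (x i) (x j)) (greedyAlgorithm.output x n)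
      (greedyAlgorithm.output x (n + 1)) :=
  (exists_isGreedyStep (fun i j : Fin (n + 2) => dist (x i) (x j))
    (greedyAlgorithm.output x n)).choose_spec

theorem isTree_output (x : ℕ → X) (n : ℕ) : (greedyAlgorithm.output x n).IsTree := by
  induction n with
  | zero =>
    have : Subsingleton (Fin (0 + 1)) := inferInstanceAs (Subsingleton (Fin 1))
    exact SimpleGraph.IsTree.of_subsingleton
  | succ n ih =>
    obtain ⟨j, -, ⟨h, -⟩ | ⟨a, b, u, v, hi, h, -⟩⟩ := isGreedyStep_output x n
    · rw [h]
      exact isTree_attach ih j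
    · rw [h]
      exact hi.2.2.2.2.2

theorem isArrivalStep_output (x : ℕ → X) (n : ℕ) :
    IsArrivalStep (greedyAlgorithm.output x n) (greedyAlgorithm.output x (n + 1)) := by
  obtain ⟨j, -, ⟨h, -⟩ | ⟨a, b, u, v, hi, h, -⟩⟩ := isGreedyStep_output x n
  · exact ⟨j, Or.inl h⟩
  · refine ⟨j, Or.inr ?_⟩
    rw [h]
    exact isSwap_swap hi.1 hi.2.2.1 hi.2.1

/-- The number of edges of length at least `t` in the tree of the greedy algorithm. -/
noncomputable def treeLongCount (x : ℕ → X) (n : ℕ) (t : ℝ) : ℕ :=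
  longCount (fun i : Fin (n + 1) => x i) (greedyAlgorithm.output x n) t

theorem treeLongCount_zero (x : ℕ → X) (t : ℝ) : treeLongCount x 0 t = 0 := by
  have : greedyAlgorithm.output x 0 = ⊥ := rfl
  rw [treeLongCount, this, longCount]
  simp

/-- Exposes the tree between attachment and swap. The attachment vertex may differ from `par (n +
1)`, but both are nearest, so the distances agree. -/
theorem isGreedyStep_output_cases {x : ℕ → X} {par : ℕ → ℕ} (hpar : ∀ v, 0 < v → par v < v)
    (hnear : ∀ v, ∀ i < v, dist (x v) (x (par v)) ≤ dist (x v) (x i)) (n : ℕ) :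
    ∃ T : SimpleGraph (Fin (n + 2)), T.IsTree ∧
      (∀ t, longCount (fun i : Fin (n + 2) => x i) T t ≤ treeLongCount x n t +
        open Classical in if t ≤ dist (x (n + 1)) (x (par (n + 1))) then 1 else 0) ∧
      ((greedyAlgorithm.output x (n + 1) = T ∧
        ∀ a b u v, ¬ IsImproving (fun i j : Fin (n + 2) => dist (x i) (x j)) T a b u v) ∨
      ∃ a b u v, IsImproving (fun i j : Fin (n + 2) => dist (x i) (x j)) T a b u v ∧
        greedyAlgorithm.output x (n + 1) = swapEdge T a b u v ∧
        ∀ a' b' u' v', IsImproving (fun i j : Fin (n + 2) => dist (x i) (x j)) T a' b' u' v' →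
          dist (x a') (x b') ≤ dist (x a) (x b)) := by
  classical
  obtain ⟨j, hj, h⟩ := isGreedyStep_output x n
  refine ⟨_, isTree_attach (isTree_output x n) j, fun t => ?_, h⟩
  have h1 := longCount_attach_le (fun i : Fin (n + 2) => x i) (greedyAlgorithm.output x n) j t
  have h2 : dist (x (n + 1)) (x (par (n + 1))) = dist (x (n + 1)) (x j) := by
    have hp := hpar (n + 1) n.succ_pos
    refine le_antisymm (hnear _ _ j.2) (hj ⟨par (n + 1), hp⟩)
  rw [h2]
  exact h1

open Classical in
theorem treeLongCount_succ_le {x : ℕ → X} {par : ℕ → ℕ} (hpar : ∀ v, 0 < v → par v < v)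
    (hnear : ∀ v, ∀ i < v, dist (x v) (x (par v)) ≤ dist (x v) (x i)) (n : ℕ) (t : ℝ) :
    treeLongCount x (n + 1) t ≤ treeLongCount x n t +
      if t ≤ dist (x (n + 1)) (x (par (n + 1))) then 1 else 0 := by
  obtain ⟨T, -, hT, ⟨h, -⟩ | ⟨a, b, u, v, hi, h, -⟩⟩ := isGreedyStep_output_cases hpar hnear n
  · rw [treeLongCount, h]
    exact hT t
  · rw [treeLongCount, h]
    refine (longCount_swap_le _ hi.1 hi.2.2.1 ?_ t).trans (hT t)
    have := hi.2.2.2.2.1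
    have : (0 : ℝ) ≤ dist (x u) (x v) := dist_nonneg
    linarith

/-- Apply `exists_isTree_swap` to the edges of length at least `64 * r`; edges of `S` have length at
most `r < 64 * r`, so the two kinds are disjoint. -/
theorem exists_isImproving {n : ℕ} (p : Fin (n + 1) → X) {T S : SimpleGraph (Fin (n + 1))}
    (hT : T.IsTree) {r : ℝ} (hr : 0 < r) (hS : ∀ u v, S.Adj u v → dist (p u) (p v) ≤ r)
    (hcard : compCount S < longCount p T (64 * r) + 1) :
    ∃ a b u v, IsImproving (fun i j => dist (p i) (p j)) T a b u v ∧
      64 * r ≤ dist (p a) (p b) := by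
  classical
  have hfin : {e ∈ T.edgeSet | 64 * r ≤ edgeLength p e}.Finite := Set.toFinite _
  rw [longCount, Set.ncard_eq_toFinset_card _ hfin] at hcard
  obtain ⟨a, b, u, v, hab, huv, hn, htree⟩ := exists_isTree_swap hT (L := hfin.toFinset)
    (S := S) (fun e he => (hfin.mem_toFinset.1 he).1) (fun e he heS => by
      have hlong := (hfin.mem_toFinset.1 he).2
      induction e with
      | _ u v =>
      have h1 := hS u v heS
      have h2 : 64 * r ≤ dist (p u) (p v) := hlong
      linarith) hcard
  obtain ⟨hadj, hlong⟩ := hfin.mem_toFinset.1 hab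
  have hlong' : 64 * r ≤ dist (p a) (p b) := hlong
  have := hS u v huv
  exact ⟨a, b, u, v, ⟨hadj, hn, huv.ne, by linarith, by linarith, htree⟩, hlong'⟩

theorem exists_level {b d : ℝ} (hb : 0 < b) (hd : b * 64 ≤ d) :
    ∃ i : ℕ, b * 64 ^ (i + 1) ≤ d ∧ d < b * 64 ^ (i + 2) := by
  obtain ⟨i, h1, h2⟩ := exists_nat_pow_near (x := d / (b * 64)) (y := 64)
    ((one_le_div (by positivity)).2 hd) (by norm_num)
  rw [le_div_iff₀ (by positivity)] at h1
  rw [div_lt_iff₀ (by positivity)] at h2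
  exact ⟨i, by rw [pow_succ]; linarith, by rw [pow_succ]; linarith⟩

theorem level_le_of_lt {b : ℝ} (hb : 0 < b) {i j : ℕ} (h : b * 64 ^ i < b * 64 ^ (j + 1)) :
    i ≤ j := by
  have h1 := lt_of_mul_lt_mul_left h hb.le
  exact Nat.lt_succ_iff.1 ((pow_lt_pow_iff_right₀ (by norm_num : (1 : ℝ) < 64)).1 h1)

open Classical in
/-- If after an arrival there are more long edges than short connections require on some level from
`l` on, then the number of edges has been decreased on such a level. -/
theorem exists_level_decrease {x : ℕ → X} {par : ℕ → ℕ} (hpar : ∀ v, 0 < v → par v < v)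
    (hnear : ∀ v, ∀ i < v, dist (x v) (x (par v)) ≤ dist (x v) (x i)) {n : ℕ} {b : ℝ} (hb : 0 < b)
    {l m : ℕ} (hm : ∀ i ≤ n + 1, ∀ j ≤ n + 1, dist (x i) (x j) < b * 64 ^ (m + 1))
    (hviol : ∃ i ∈ Finset.Ico l m, compCount (proximityGraph x (n + 1) (b * 64 ^ i)) <
      treeLongCount x (n + 1) (b * 64 ^ (i + 1)) + 1) :
    ∃ i ∈ Finset.Ico l m, treeLongCount x (n + 1) (b * 64 ^ (i + 1)) + 1 ≤
      treeLongCount x n (b * 64 ^ (i + 1)) +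
        if b * 64 ^ (i + 1) ≤ dist (x (n + 1)) (x (par (n + 1))) then 1 else 0 := by
  obtain ⟨i, hi, hviol⟩ := hviol
  obtain ⟨T, htree, hT, hcases⟩ := isGreedyStep_output_cases hpar hnear n
  have hmono : ∀ t, treeLongCount x (n + 1) t ≤ longCount (fun i : Fin (n + 2) => x i) T t := by
    intro t
    obtain ⟨h, -⟩ | ⟨a, b, u, v, hi, h, -⟩ := hcases
    · rw [treeLongCount, h]
    · rw [treeLongCount, h]
      refine longCount_swap_le _ hi.1 hi.2.2.1 ?_ t
      have := hi.2.2.2.2.1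
      have : (0 : ℝ) ≤ dist (x u) (x v) := dist_nonneg
      linarith
  have h64 : b * 64 ^ (i + 1) = 64 * (b * 64 ^ i) := by rw [pow_succ]; ring
  obtain ⟨a', b', u', v', himp, hlong⟩ := exists_isImproving (fun i : Fin (n + 2) => x i) htree
    (by positivity : 0 < b * 64 ^ i) (S := proximityGraph x (n + 1) (b * 64 ^ i))
    (fun u v h => h.2) (by have := hmono (b * 64 ^ (i + 1)); rw [h64] at this hviol; omega)
  rw [← h64] at hlong
  obtain ⟨-, hno⟩ | ⟨a, c, u, v, himp', h, hmax⟩ := hcases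
  · exact absurd himp (hno _ _ _ _)
  -- The swap performed removes a longest edge, so its level `k` is at least `i` and stays in the
  -- range. The new edge is 64 times shorter and drops below `b * 64 ^ (k + 1)`.
  have hlen : b * 64 ^ (i + 1) ≤ dist (x a) (x c) := hlong.trans (hmax _ _ _ _ himp)
  obtain ⟨k, hk1, hk2⟩ := exists_level hb (d := dist (x a) (x c)) (le_trans (by
    refine mul_le_mul_of_nonneg_left ?_ hb.le
    exact le_self_pow₀ (by norm_num) (by omega)) hlen)
  have hik : i + 1 ≤ k + 1 := level_le_of_lt hb (hlen.trans_lt hk2)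
  have hkm : k + 1 ≤ m := level_le_of_lt hb (hk1.trans_lt
    (hm a (Nat.lt_succ_iff.1 a.2) c (Nat.lt_succ_iff.1 c.2)))
  have hi' := Finset.mem_Ico.1 hi
  refine ⟨k, Finset.mem_Ico.2 ⟨by omega, by omega⟩, le_trans ?_ (hT _)⟩
  rw [treeLongCount, h]
  refine longCount_swap_lt (fun i : Fin (n + 2) => x i) himp'.1 himp'.2.2.1 ?_ hk1
  have h1 : 64 * dist (x u) (x v) ≤ dist (x a) (x c) := himp'.2.2.2.2.1
  have h2 : b * 64 ^ (k + 2) = 64 * (b * 64 ^ (k + 1)) := by rw [pow_succ]; ring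
  rw [h2] at hk2
  change dist (x u) (x v) < _
  linarith

open Classical in
/-- Since some earlier time `s` at which there were not too many long edges, every arrival has
decreased the number of long edges, summed over the levels from `l` on. -/
theorem exists_stable_time {x : ℕ → X} {par : ℕ → ℕ} (hpar : ∀ v, 0 < v → par v < v)
    (hnear : ∀ v, ∀ i < v, dist (x v) (x (par v)) ≤ dist (x v) (x i)) {N : ℕ} {b : ℝ} (hb : 0 < b)
    {l m : ℕ} (hm : ∀ i ≤ N, ∀ j ≤ N, dist (x i) (x j) < b * 64 ^ (m + 1)) (n : ℕ) (hn : n ≤ N) :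
    ∃ s ≤ n, ∑ i ∈ Finset.Ico l m, (treeLongCount x n (b * 64 ^ (i + 1)) : ℝ) ≤
      ∑ i ∈ Finset.Ico l m, ((compCount (proximityGraph x s (b * 64 ^ i)) : ℝ) - 1 +
        ((Finset.Ioc s n).filter fun v => b * 64 ^ i < dist (x v) (x (par v))).card) -
      ((n : ℝ) - s) := by
  have hstable : ∀ n, (∀ i ∈ Finset.Ico l m, treeLongCount x n (b * 64 ^ (i + 1)) + 1 ≤
      compCount (proximityGraph x n (b * 64 ^ i))) →
      ∃ s ≤ n, ∑ i ∈ Finset.Ico l m, (treeLongCount x n (b * 64 ^ (i + 1)) : ℝ) ≤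
      ∑ i ∈ Finset.Ico l m, ((compCount (proximityGraph x s (b * 64 ^ i)) : ℝ) - 1 +
        ((Finset.Ioc s n).filter fun v => b * 64 ^ i < dist (x v) (x (par v))).card) -
      ((n : ℝ) - s) := by
    intro n h
    refine ⟨n, le_rfl, ?_⟩
    rw [sub_self, sub_zero]
    refine Finset.sum_le_sum fun i hi => ?_
    have : (treeLongCount x n (b * 64 ^ (i + 1)) : ℝ) + 1 ≤
      compCount (proximityGraph x n (b * 64 ^ i)) := by exact_mod_cast h i hi
    have h0 : (0 : ℝ) ≤
      ((Finset.Ioc n n).filter fun v => b * 64 ^ i < dist (x v) (x (par v))).card :=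
      Nat.cast_nonneg _
    linarith
  induction n with
  | zero =>
    refine hstable 0 fun i _ => ?_
    rw [treeLongCount_zero]
    exact compCount_pos _
  | succ n ih =>
    by_cases hst : ∀ i ∈ Finset.Ico l m, treeLongCount x (n + 1) (b * 64 ^ (i + 1)) + 1 ≤
      compCount (proximityGraph x (n + 1) (b * 64 ^ i))
    · exact hstable _ hst
    push Not at hst
    obtain ⟨i₀, hi₀, hdec⟩ := exists_level_decrease hpar hnear hb (l := l) (m := m)
      (fun i hi j hj => hm i (hi.trans hn) j (hj.trans hn)) hst
    obtain ⟨s, hs, hsum⟩ := ih (by omega)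
    refine ⟨s, by omega, ?_⟩
    have hcard : ∀ t : ℝ, (((Finset.Ioc s (n + 1)).filter fun v =>
        t < dist (x v) (x (par v))).card : ℝ) =
        ((Finset.Ioc s n).filter fun v => t < dist (x v) (x (par v))).card +
          if t < dist (x (n + 1)) (x (par (n + 1))) then 1 else 0 := by
      intro t
      rw [← Finset.insert_Ioc_right_eq_Ioc_add_one (by omega : s ≤ n), Finset.filter_insert]
      split_ifs with h
      · rw [Finset.card_insert_of_notMem (by simp)]
        push_cast; rfl
      · simp
    -- Arrivals are counted at the smaller threshold of the cluster scale, the form that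
    -- `clusters_persist` bounds.
    have hle : ∀ i, (if b * 64 ^ (i + 1) ≤ dist (x (n + 1)) (x (par (n + 1))) then 1 else 0 : ℕ) ≤
        if b * 64 ^ i < dist (x (n + 1)) (x (par (n + 1))) then 1 else 0 := by
      intro i
      have : b * 64 ^ i < b * 64 ^ (i + 1) := by
        have : 0 < b * 64 ^ i := by positivity
        rw [pow_succ]; linarith
      split_ifs with h1 h2 <;> first | omega | exact absurd (this.trans_le h1) h2
    have hterm : ∑ i ∈ Finset.Ico l m, treeLongCount x (n + 1) (b * 64 ^ (i + 1)) + 1 ≤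
        ∑ i ∈ Finset.Ico l m, (treeLongCount x n (b * 64 ^ (i + 1)) +
          if b * 64 ^ i < dist (x (n + 1)) (x (par (n + 1))) then 1 else 0) := by
      refine Nat.succ_le_of_lt (Finset.sum_lt_sum (fun i _ => ?_) ⟨i₀, hi₀, ?_⟩)
      · have h1 := treeLongCount_succ_le hpar hnear n (b * 64 ^ (i + 1))
        have h2 := hle i
        omega
      · have h2 := hle i₀
        omega
    have hterm' : ∑ i ∈ Finset.Ico l m, (treeLongCount x (n + 1) (b * 64 ^ (i + 1)) : ℝ) + 1 ≤
        ∑ i ∈ Finset.Ico l m, ((treeLongCount x n (b * 64 ^ (i + 1)) : ℝ) +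
          if b * 64 ^ i < dist (x (n + 1)) (x (par (n + 1))) then 1 else 0) := by
      exact_mod_cast hterm
    simp only [hcard, ← add_assoc]
    rw [Finset.sum_add_distrib] at hterm' ⊢
    push_cast
    linarith

end Algorithm

/-! ### Tours and the lower bound for the optimum -/

section Tour

variable {X : Type*} [MetricSpace X]

/-- The length of a polygonal path. -/
noncomputable def pathLength : List X → ℝ
  | [] => 0
  | [_] => 0
  | a :: b :: l => dist a b + pathLength (b :: l)

theorem pathLength_insert_detour (a b : X) (l₁ l₂ : List X) :
    pathLength (l₁ ++ a :: b :: a :: l₂) = pathLength (l₁ ++ a :: l₂) + 2 * dist a b := by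
  induction l₁ with
  | nil =>
    simp only [List.nil_append, pathLength]
    rw [dist_comm b a]; ring
  | cons c l ih =>
    cases l with
    | nil =>
      simp only [List.cons_append, List.nil_append, pathLength] at ih ⊢
      linarith
    | cons d l =>
      simp only [List.cons_append, pathLength] at ih ⊢
      linarith

theorem pathLength_cons_le_of_sublist {l₁ l₂ : List X} (h : l₁.Sublist l₂) :
    ∀ a, pathLength (a :: l₁) ≤ pathLength (a :: l₂) := by
  induction h with
  | slnil => exact fun a => le_rfl
  | @cons l₁ l₂ c _ ih =>
    intro a
    refine (ih a).trans ?_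
    cases l₂ with
    | nil =>
      simp only [pathLength]
      linarith [dist_nonneg (x := a) (y := c)]
    | cons d l =>
      simp only [pathLength]
      linarith [dist_triangle a c d]
  | cons_cons c _ ih =>
    intro a
    simp only [pathLength]
    linarith [ih c]

theorem pathLength_le_cons (a : X) (l : List X) : pathLength l ≤ pathLength (a :: l) := by
  cases l with
  | nil => exact le_rfl
  | cons b l =>
    simp only [pathLength]
    linarith [dist_nonneg (x := a) (y := b)]

theorem pathLength_le_of_sublist {l₁ l₂ : List X} (h : l₁.Sublist l₂) :
    pathLength l₁ ≤ pathLength l₂ := by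
  induction h with
  | slnil => exact le_rfl
  | cons c _ ih => exact ih.trans (pathLength_le_cons c _)
  | cons_cons c h _ => exact pathLength_cons_le_of_sublist h c

/-- A connected graph is traversed by a path of at most twice its cost. -/
theorem exists_tour {V : Type*} [Fintype V] (p : V → X) {G : SimpleGraph V} (hG : G.Connected) :
    ∃ L : List V, (∀ v, v ∈ L) ∧ pathLength (L.map p) ≤ 2 * cost p G := by
  classical
  have hne : Nonempty V := hG.nonempty
  have hlen0 : ∀ e, 0 ≤ edgeLength p e := fun e => by
    induction e with
    | _ u v => exact dist_nonneg
  have key : ∀ k, k + 1 ≤ Fintype.card V → ∃ L : List V, L.toFinset.card = k + 1 ∧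
      ∃ E : Finset (Sym2 V), (E : Set (Sym2 V)) ⊆ G.edgeSet ∧ (∀ e ∈ E, ∀ v ∈ e, v ∈ L) ∧
        pathLength (L.map p) ≤ 2 * ∑ e ∈ E, edgeLength p e := by
    intro k
    induction k with
    | zero =>
      intro _
      obtain ⟨v⟩ := hne
      exact ⟨[v], by simp, ∅, by simp, by simp, by simp [pathLength]⟩
    | succ k ih =>
      intro hk
      obtain ⟨L, hL, E, hE, hEL, hlen⟩ := ih (by omega)
      have hu : ∃ u, u ∈ L.toFinset := by
        rw [← Finset.Nonempty, ← Finset.card_pos]; omega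
      have hw : ∃ w, w ∉ L.toFinset := by
        by_contra hcon
        push Not at hcon
        have := Finset.eq_univ_iff_forall.2 hcon
        rw [this, Finset.card_univ] at hL
        omega
      obtain ⟨u, hu⟩ := hu
      obtain ⟨w, hw⟩ := hw
      obtain ⟨q⟩ := hG u w
      -- An edge `ab` leaving the visited set is inserted as a detour `a, b, a`. It has not been
      -- paid for before, since `b` was unvisited.
      obtain ⟨d, -, hd1, hd2⟩ := q.exists_boundary_dart (L.toFinset : Set V) hu hw
      obtain ⟨⟨a, b⟩, hab⟩ := d
      have ha : a ∈ L := by simpa using hd1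
      have hb : b ∉ L := by simpa using hd2
      obtain ⟨l₁, l₂, rfl⟩ := List.append_of_mem ha
      have hmem : ∀ v, v ∈ l₁ ++ a :: b :: a :: l₂ ↔ v = b ∨ v ∈ l₁ ++ a :: l₂ := by
        intro v
        simp only [List.mem_append, List.mem_cons]
        tauto
      refine ⟨l₁ ++ a :: b :: a :: l₂, ?_, insert s(a, b) E, ?_, ?_, ?_⟩
      · have : (l₁ ++ a :: b :: a :: l₂).toFinset = insert b (l₁ ++ a :: l₂).toFinset := by
          ext v
          rw [Finset.mem_insert, List.mem_toFinset, List.mem_toFinset, hmem]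
        rw [this, Finset.card_insert_of_notMem (by rwa [List.mem_toFinset]), hL]
      · rw [Finset.coe_insert, Set.insert_subset_iff]
        exact ⟨hab, hE⟩
      · intro e he v hv
        rw [hmem]
        rcases Finset.mem_insert.1 he with rfl | he
        · rcases Sym2.mem_iff.1 hv with rfl | rfl
          · exact Or.inr ha
          · exact Or.inl rfl
        · exact Or.inr (hEL e he v hv)
      · have hnew : s(a, b) ∉ E := fun h => hb (hEL _ h b (by simp))
        rw [Finset.sum_insert hnew]
        simp only [List.map_append, List.map_cons] at hlen ⊢
        rw [pathLength_insert_detour]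
        have : edgeLength p s(a, b) = dist (p a) (p b) := rfl
        linarith
  obtain ⟨L, hL, E, hE, -, hlen⟩ := key (Fintype.card V - 1) (by
    have := Fintype.card_pos (α := V); omega)
  refine ⟨L, fun v => ?_, hlen.trans ?_⟩
  · have : L.toFinset = Finset.univ := by
      rw [← Finset.card_eq_iff_eq_univ]
      have := Fintype.card_pos (α := V); omega
    rw [← List.mem_toFinset, this]
    exact Finset.mem_univ v
  · unfold cost
    refine mul_le_mul_of_nonneg_left (Finset.sum_le_sum_of_subset_of_nonneg (fun e he => ?_)
      fun e _ _ => hlen0 e) zero_le_two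
    exact SimpleGraph.mem_edgeFinset.2 (hE he)

open Classical in
/-- The number of steps of length more than `r` of a polygonal path. -/
noncomputable def longSteps (r : ℝ) : List X → ℕ
  | [] => 0
  | [_] => 0
  | a :: b :: l => (if r < dist a b then 1 else 0) + longSteps r (b :: l)

/-- Cutting the path at its long steps leaves pieces that each lie in one component. Only the points
have to be covered, not the indices, since points may repeat. -/
theorem compCount_proximityGraph_le {x : ℕ → X} {n : ℕ} {r : ℝ} (hr : 0 ≤ r)
    {L : List (Fin (n + 1))} (hne : L ≠ [])
    (hL : ∀ v : Fin (n + 1), ∃ w ∈ L, x w = x v) :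
    compCount (proximityGraph x n r) ≤ longSteps r (L.map fun i : Fin (n + 1) => x i) + 1 := by
  classical
  have hreach : ∀ u v : Fin (n + 1), dist (x u) (x v) ≤ r →
      (proximityGraph x n r).Reachable u v := fun u v h => by
    by_cases huv : u = v
    · rw [huv]
    · exact SimpleGraph.Adj.reachable ⟨huv, h⟩
  have key : ∀ L : List (Fin (n + 1)), L ≠ [] → ∃ R : Finset (Fin (n + 1)),
      R.card ≤ longSteps r (L.map fun i : Fin (n + 1) => x i) + 1 ∧
      ∀ w ∈ L, ∃ v ∈ R, (proximityGraph x n r).Reachable v w := by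
    intro L hL
    induction L with
    | nil => exact absurd rfl hL
    | cons a l ih =>
      cases l with
      | nil => exact ⟨{a}, by simp [longSteps], by simp⟩
      | cons b l =>
        obtain ⟨R, hR, hRl⟩ := ih (by simp)
        simp only [List.map_cons, longSteps] at hR ⊢
        by_cases hab : r < dist (x a) (x b)
        · refine ⟨insert a R, ?_, fun w hw => ?_⟩
          · rw [if_pos hab]
            have := Finset.card_insert_le a R
            omega
          · rcases List.mem_cons.1 hw with rfl | hw
            · exact ⟨w, Finset.mem_insert_self _ _, .rfl⟩
            · obtain ⟨v, hv, hvw⟩ := hRl w hw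
              exact ⟨v, Finset.mem_insert_of_mem hv, hvw⟩
        · refine ⟨R, by rw [if_neg hab]; omega, fun w hw => ?_⟩
          rcases List.mem_cons.1 hw with rfl | hw
          · obtain ⟨v, hv, hvb⟩ := hRl b (by simp)
            exact ⟨v, hv, hvb.trans (hreach _ _ (not_lt.1 hab)).symm⟩
          · exact hRl w hw
  obtain ⟨R, hR, hRL⟩ := key L hne
  refine le_trans ?_ hR
  have := compCount_le_of_surj (G := proximityGraph x n r) (fun v : R => (v : Fin (n + 1)))
    fun v => by
      obtain ⟨w, hw, hwv⟩ := hL v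
      obtain ⟨u, hu, huw⟩ := hRL w hw
      exact ⟨⟨u, hu⟩, huw.trans (hreach _ _ (by rw [hwv, dist_self]; exact hr))⟩
  rwa [Nat.card_eq_fintype_card, Fintype.card_coe] at this

theorem sum_pow_levels_le {c : ℝ} (hc : 0 ≤ c) (m : ℕ) :
    ∑ i ∈ Finset.range (m + 1), c * 64 ^ i ≤ 2 * (c * 64 ^ m) := by
  induction m with
  | zero => simp; linarith
  | succ m ih =>
    rw [Finset.sum_range_succ]
    have h1 : c * 64 ^ (m + 1) = 64 * (c * 64 ^ m) := by rw [pow_succ]; ring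
    have h2 : 0 ≤ c * 64 ^ m := by positivity
    linarith

open Classical in
theorem sum_levels_below_le {c d : ℝ} (hc : 0 ≤ c) (hd : 0 ≤ d) (m : ℕ) :
    ∑ i ∈ Finset.range m, (if c * 64 ^ i < d then c * 64 ^ i else 0) ≤ 2 * d := by
  induction m with
  | zero => simpa using hd
  | succ m ih =>
    by_cases h : c * 64 ^ m < d
    · refine le_trans (Finset.sum_le_sum fun i _ => ?_)
        ((sum_pow_levels_le hc m).trans (by linarith))
      split_ifs
      · exact le_rfl
      · positivity
    · rw [Finset.sum_range_succ, if_neg h, add_zero]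
      exact ih

/-- A step of length `d` counts only on scales below `d`, and these form a geometric sum of at most
`2 * d`. -/
theorem sum_longSteps_le {c : ℝ} (hc : 0 ≤ c) (m : ℕ) (L : List X) :
    ∑ i ∈ Finset.range m, (longSteps (c * 64 ^ i) L : ℝ) * (c * 64 ^ i) ≤ 2 * pathLength L := by
  classical
  induction L with
  | nil => simp [longSteps, pathLength]
  | cons a l ih =>
    cases l with
    | nil => simp [longSteps, pathLength]
    | cons b l =>
      simp only [longSteps, pathLength]
      have h := sum_levels_below_le hc (dist_nonneg (x := a) (y := b)) m
      have h2 : ∀ i, (((if c * 64 ^ i < dist a b then 1 else 0) +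
          longSteps (c * 64 ^ i) (b :: l) : ℕ) : ℝ) * (c * 64 ^ i) =
          (if c * 64 ^ i < dist a b then c * 64 ^ i else 0) +
            (longSteps (c * 64 ^ i) (b :: l) : ℝ) * (c * 64 ^ i) := by
        intro i
        split_ifs <;> push_cast <;> ring
      simp only [h2, Finset.sum_add_distrib]
      linarith

/-- A lower bound for the cost of an optimal Steiner tree in terms of the numbers of clusters on
geometrically growing scales. -/
theorem sum_clusters_le_steinerOpt (x : ℕ → X) (n : ℕ) {c : ℝ} (hc : 0 ≤ c) (m : ℕ) :
    ∑ i ∈ Finset.range m, ((compCount (proximityGraph x n (c * 64 ^ i)) : ℝ) - 1) * (c * 64 ^ i) ≤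
      4 * steinerOpt (x '' Set.Iic n) := by
  classical
  rw [← div_le_iff₀' (by norm_num)]
  refine le_csInf (steinerCosts_nonempty _ ((Set.finite_Iic n).image x)
    ⟨x n, n, Set.mem_Iic.2 le_rfl, rfl⟩) ?_
  rintro _ ⟨S, G, hS, hG, rfl⟩
  obtain ⟨L, hL, hlen⟩ := exists_tour (fun s : S => (s : X)) hG.connected
  -- Skipping the Steiner points does not lengthen the tour, and leaves a path through terminals
  -- only.
  set L' := (L.map fun s : S => (s : X)).filter fun y => y ∈ x '' Set.Iic n with hL'
  have hmem : ∀ i ≤ n, x i ∈ L' := fun i hi => by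
    have hR : x i ∈ x '' Set.Iic n := ⟨i, hi, rfl⟩
    rw [hL', List.mem_filter]
    exact ⟨List.mem_map.2 ⟨⟨x i, hS hR⟩, hL _, rfl⟩, by simpa using hR⟩
  have hlen' : pathLength L' ≤ 2 * cost (fun s : S => (s : X)) G :=
    (pathLength_le_of_sublist List.filter_sublist).trans hlen
  have hrange : L' ∈ Set.range (List.map fun i : Fin (n + 1) => x i) := by
    rw [Set.range_list_map]
    intro y hy
    obtain ⟨i, hi, rfl⟩ : y ∈ x '' Set.Iic n := by simpa using (List.mem_filter.1 hy).2
    exact ⟨⟨i, Nat.lt_succ_of_le hi⟩, rfl⟩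
  obtain ⟨L'', hL''⟩ := hrange
  have hne : L'' ≠ [] := by
    rintro rfl
    have := hmem n le_rfl
    rw [← hL''] at this
    simp at this
  have hcov : ∀ v : Fin (n + 1), ∃ w ∈ L'', x w = x v := fun v => by
    have := hmem v (Nat.lt_succ_iff.1 v.2)
    rw [← hL''] at this
    simpa using this
  have hsum := sum_longSteps_le hc m L'
  have : ∑ i ∈ Finset.range m,
      ((compCount (proximityGraph x n (c * 64 ^ i)) : ℝ) - 1) * (c * 64 ^ i) ≤
      ∑ i ∈ Finset.range m, (longSteps (c * 64 ^ i) L' : ℝ) * (c * 64 ^ i) := by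
    refine Finset.sum_le_sum fun i _ => ?_
    have h0 : 0 ≤ c * 64 ^ i := by positivity
    refine mul_le_mul_of_nonneg_right ?_ h0
    have h1 := compCount_proximityGraph_le h0 hne hcov
    rw [hL''] at h1
    have : (compCount (proximityGraph x n (c * 64 ^ i)) : ℝ) ≤ longSteps (c * 64 ^ i) L' + 1 := by
      exact_mod_cast h1
    linarith
  rw [div_le_iff₀' (by norm_num)]
  linarith

end Tour

/-! ### Charging arrivals and summing over levels -/

section Cost

variable {X : Type*} [MetricSpace X]

open Classical in
/-- The weight with which an arrival at distance `d` is charged for merging clusters that are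
separated by `64 * r`. -/
noncomputable def mergeWeight (d r : ℝ) : ℝ :=
  if d ≤ r then d / r else if d ≤ 64 * r then 1 else 0

theorem sum_mergeWeight_le {b d : ℝ} (hb : 0 < b) (hd : 0 ≤ d) (l m : ℕ) :
    ∑ i ∈ Finset.Ico l m, mergeWeight d (b * 64 ^ i) ≤ 3 := by
  classical
  -- A potential with values in `[0, 3]` that falls by at least the weight when the scale grows by
  -- 64, so the sum telescopes.
  let ψ : ℝ → ℝ := fun r => if d ≤ r then 2 * (d / r) else 3
  have hψ : ∀ r, 0 < r → mergeWeight d r ≤ ψ r - ψ (64 * r) := by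
    intro r hr
    have h64 : d / (64 * r) = d / r / 64 := by rw [mul_comm, div_div]
    simp only [mergeWeight, ψ]
    by_cases h1 : d ≤ r
    · have h2 : d ≤ 64 * r := by linarith
      have h3 : 0 ≤ d / r := by positivity
      rw [if_pos h1, if_pos h1, if_pos h2, h64]
      linarith
    · by_cases h2 : d ≤ 64 * r
      · have h3 : d / (64 * r) ≤ 1 := (div_le_one (by positivity)).2 h2
        rw [if_neg h1, if_neg h1, if_pos h2, if_pos h2]
        linarith
      · rw [if_neg h1, if_neg h1, if_neg h2, if_neg h2, sub_self]
  have hnonneg : ∀ r, 0 < r → 0 ≤ mergeWeight d r := by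
    intro r hr
    unfold mergeWeight
    split_ifs
    · positivity
    · exact zero_le_one
    · exact le_rfl
  have hψ0 : ∀ r, 0 < r → 0 ≤ ψ r := by
    intro r hr
    simp only [ψ]
    split_ifs
    · positivity
    · norm_num
  have hψ3 : ∀ r, 0 < r → ψ r ≤ 3 := by
    intro r hr
    simp only [ψ]
    split_ifs with h
    · have := (div_le_one hr).2 h
      linarith
    · exact le_rfl
  have hpos : ∀ i : ℕ, 0 < b * 64 ^ i := fun i => by positivity
  calc ∑ i ∈ Finset.Ico l m, mergeWeight d (b * 64 ^ i)
      ≤ ∑ i ∈ Finset.range m, mergeWeight d (b * 64 ^ i) :=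
        Finset.sum_le_sum_of_subset_of_nonneg
          (fun i hi => Finset.mem_range.2 (Finset.mem_Ico.1 hi).2) fun i _ _ => hnonneg _ (hpos i)
    _ ≤ ∑ i ∈ Finset.range m, (ψ (b * 64 ^ i) - ψ (b * 64 ^ (i + 1))) := by
        refine Finset.sum_le_sum fun i _ => ?_
        have : b * 64 ^ (i + 1) = 64 * (b * 64 ^ i) := by rw [pow_succ]; ring
        rw [this]
        exact hψ _ (hpos i)
    _ = ψ (b * 64 ^ 0) - ψ (b * 64 ^ m) := Finset.sum_range_sub' _ _
    _ ≤ 3 := by linarith [hψ0 _ (hpos m), hψ3 _ (hpos 0)]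

theorem clusters_persist_weighted (x : ℕ → X) {s n : ℕ} (hsn : s ≤ n) {par : ℕ → ℕ}
    (hpar : ∀ v, 0 < v → par v < v)
    (hnear : ∀ v, ∀ i < v, dist (x v) (x (par v)) ≤ dist (x v) (x i)) {r : ℝ} (hr : 0 < r) :
    15 * ((compCount (proximityGraph x s (64 * r)) : ℝ) - 1 +
        ((Finset.Ioc s n).filter fun v => 64 * r < dist (x v) (x (par v))).card) ≤
      32 * ((compCount (proximityGraph x n r) : ℝ) - 1) +
      ∑ v ∈ Finset.Ioc s n, mergeWeight (dist (x v) (x (par v))) r := by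
  classical
  have h := clusters_persist x hsn hpar hnear hr (by linarith : r ≤ 64 * r)
  set δ : ℕ → ℝ := fun v => dist (x v) (x (par v)) with hδ
  have hw : ∑ v ∈ Finset.Ioc s n, mergeWeight (δ v) r =
      (∑ v ∈ (Finset.Ioc s n).filter (fun v => δ v ≤ r), δ v) / r +
      (((Finset.Ioc s n).filter fun v => r < δ v).card -
        ((Finset.Ioc s n).filter fun v => 64 * r < δ v).card) := by
    rw [Finset.sum_div, Finset.sum_filter, Finset.card_filter, Finset.card_filter]
    push_cast
    rw [← Finset.sum_sub_distrib, ← Finset.sum_add_distrib]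
    refine Finset.sum_congr rfl fun v _ => ?_
    unfold mergeWeight
    by_cases h1 : δ v ≤ r
    · rw [if_pos h1, if_pos h1, if_neg (not_lt.2 h1), if_neg (by linarith)]
      ring
    · by_cases h2 : δ v ≤ 64 * r
      · rw [if_neg h1, if_pos h2, if_neg h1, if_pos (not_le.1 h1), if_neg (not_lt.2 h2)]
        ring
      · rw [if_neg h1, if_neg h2, if_neg h1, if_pos (not_le.1 h1), if_pos (not_le.1 h2)]
        ring
  rw [hw]
  set S := ∑ v ∈ (Finset.Ioc s n).filter (fun v => δ v ≤ r), δ v with hS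
  have hSr : S = S / r * r := by field_simp
  set u := S / r
  rw [hSr] at h
  -- With `ρ = 64 * r`, division by `2 * r` gives the left side the factor 16; one copy cancels
  -- against the `E1` term, leaving 15. Arrivals beyond `64 * r` cancel there too, which is why
  -- their weight is 0.
  refine le_of_mul_le_mul_right ?_ (by linarith : 0 < 2 * r)
  linarith

/-- On the levels from `l` on, the number of long edges of the tree is controlled by the number of
clusters. -/
theorem sum_treeLongCount_le (x : ℕ → X) {n : ℕ} {b : ℝ} (hb : 0 < b) {l m : ℕ}
    (hm : ∀ i ≤ n, ∀ j ≤ n, dist (x i) (x j) < b * 64 * 64 ^ (m + 1)) :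
    ∑ i ∈ Finset.Ico l m, (treeLongCount x n (b * 64 * 64 ^ (i + 1)) : ℝ) ≤
      3 * ∑ i ∈ Finset.Ico l m, ((compCount (proximityGraph x n (b * 64 ^ i)) : ℝ) - 1) := by
  classical
  have hex : ∀ v : ℕ, ∃ p : ℕ, (0 < v → p < v) ∧ ∀ i < v, dist (x v) (x p) ≤ dist (x v) (x i) := by
    intro v
    rcases Nat.eq_zero_or_pos v with rfl | hv
    · exact ⟨0, by simp, by simp⟩
    · obtain ⟨p, hp, hmin⟩ := Finset.exists_min_image (Finset.range v) (fun i => dist (x v) (x i))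
        ⟨0, Finset.mem_range.2 hv⟩
      exact ⟨p, fun _ => Finset.mem_range.1 hp, fun i hi => hmin i (Finset.mem_range.2 hi)⟩
  choose par hpar hnear using hex
  obtain ⟨s, hs, hsum⟩ := exists_stable_time hpar hnear (by positivity : 0 < b * 64) (l := l) hm n
    le_rfl
  refine hsum.trans ?_
  set M := ∑ i ∈ Finset.Ico l m, ((compCount (proximityGraph x n (b * 64 ^ i)) : ℝ) - 1) with hM
  have hM0 : 0 ≤ M := Finset.sum_nonneg fun i _ => by
    have : (1 : ℝ) ≤ compCount (proximityGraph x n (b * 64 ^ i)) := by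
      exact_mod_cast compCount_pos (proximityGraph x n (b * 64 ^ i))
    linarith
  have hterm : ∀ i, 15 * ((compCount (proximityGraph x s (b * 64 * 64 ^ i)) : ℝ) - 1 +
        ((Finset.Ioc s n).filter fun v => b * 64 * 64 ^ i < dist (x v) (x (par v))).card) ≤
      32 * ((compCount (proximityGraph x n (b * 64 ^ i)) : ℝ) - 1) +
      ∑ v ∈ Finset.Ioc s n, mergeWeight (dist (x v) (x (par v))) (b * 64 ^ i) := by
    intro i
    have h := clusters_persist_weighted x hs hpar hnear (by positivity : 0 < b * 64 ^ i)
    have h64 : 64 * (b * 64 ^ i) = b * 64 * 64 ^ i := by ring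
    rwa [h64] at h
  have hadd := Finset.sum_le_sum fun i (_ : i ∈ Finset.Ico l m) => hterm i
  rw [← Finset.mul_sum, Finset.sum_add_distrib, Finset.sum_add_distrib, ← Finset.mul_sum,
    Finset.sum_comm, ← hM] at hadd
  rw [Finset.sum_add_distrib]
  have hw : ∑ v ∈ Finset.Ioc s n, ∑ i ∈ Finset.Ico l m,
      mergeWeight (dist (x v) (x (par v))) (b * 64 ^ i) ≤ 3 * ((n : ℝ) - s) := by
    refine (Finset.sum_le_card_nsmul _ _ 3 fun v _ => sum_mergeWeight_le hb dist_nonneg l m).trans ?_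
    rw [Nat.card_Ioc, nsmul_eq_mul, Nat.cast_sub hs]
    linarith
  have hns : (0 : ℝ) ≤ (n : ℝ) - s := by
    have : (s : ℝ) ≤ n := by exact_mod_cast hs
    linarith
  -- If `A` is the sum of clusters and far arrivals, then `15 * A ≤ 32 * M + 3 * (n - s)`, so `A -
  -- (n - s) ≤ 3 * M`.
  linarith

theorem cost_le_sum_longCount {V : Type*} [Fintype V] (p : V → X) (G : SimpleGraph V) {b : ℝ}
    (hb : 0 < b) {m : ℕ} (h1 : ∀ u v, dist (p u) (p v) = 0 ∨ b * 64 ≤ dist (p u) (p v))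
    (h2 : ∀ u v, dist (p u) (p v) < b * 64 ^ (m + 1)) :
    cost p G ≤ ∑ i ∈ Finset.range m, (longCount p G (b * 64 ^ (i + 1)) : ℝ) * (b * 64 ^ (i + 2)) := by
  classical
  have hcount : ∀ t, (longCount p G t : ℝ) =
      ∑ e ∈ G.edgeFinset, if t ≤ edgeLength p e then 1 else 0 := by
    intro t
    rw [← Nat.cast_one, ← Nat.cast_zero]
    simp only [← Nat.cast_ite]
    rw [← Nat.cast_sum, ← Finset.card_filter, longCount, ← Set.ncard_coe_finset]
    congr 2
    ext e
    simp
  simp only [hcount, Finset.sum_mul]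
  rw [Finset.sum_comm]
  refine Finset.sum_le_sum fun e _ => ?_
  induction e with
  | _ u v =>
  have hlen : edgeLength p s(u, v) = dist (p u) (p v) := rfl
  rw [hlen]
  have hnonneg : ∀ i : ℕ, 0 ≤ (if b * 64 ^ (i + 1) ≤ dist (p u) (p v) then (1 : ℝ) else 0) *
      (b * 64 ^ (i + 2)) := fun i => by
    split_ifs
    · positivity
    · simp
  rcases h1 u v with h0 | hlong
  · rw [h0] at hnonneg ⊢
    exact Finset.sum_nonneg fun i _ => hnonneg i
  · obtain ⟨i, hi1, hi2⟩ := exists_level hb hlong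
    have him : i + 1 ≤ m := level_le_of_lt hb (hi1.trans_lt (h2 u v))
    refine le_trans ?_ (Finset.single_le_sum (fun i _ => hnonneg i) (Finset.mem_range.2 him))
    rw [if_pos hi1, one_mul]
    exact hi2.le

theorem cost_output_le (x : ℕ → X) (n : ℕ) :
    cost (fun i : Fin (n + 1) => x i) (greedyAlgorithm.output x n) ≤
      2 * 6 ^ 10 * steinerOpt (x '' Set.Iic n) := by
  classical
  obtain ⟨c, hc, hcmin⟩ : ∃ c : ℝ, 0 < c ∧ ∀ u v : Fin (n + 1),
      dist (x u) (x v) = 0 ∨ c ≤ dist (x u) (x v) := by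
    by_cases hne : ∃ q : Fin (n + 1) × Fin (n + 1), 0 < dist (x q.1) (x q.2)
    · obtain ⟨q, hq⟩ := hne
      have : Nonempty {q : Fin (n + 1) × Fin (n + 1) // 0 < dist (x q.1) (x q.2)} := ⟨⟨q, hq⟩⟩
      obtain ⟨q₀, hq₀⟩ := Finite.exists_min
        fun q : {q : Fin (n + 1) × Fin (n + 1) // 0 < dist (x q.1) (x q.2)} =>
          dist (x q.1.1) (x q.1.2)
      refine ⟨_, q₀.2, fun u v => ?_⟩
      rcases (dist_nonneg (x := x u) (y := x v)).eq_or_lt with h | h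
      · exact Or.inl h.symm
      · exact Or.inr (hq₀ ⟨(u, v), h⟩)
    · push Not at hne
      exact ⟨1, one_pos, fun u v => Or.inl (le_antisymm (hne (u, v)) dist_nonneg)⟩
  -- The smallest positive distance lies two scales above `b`: one scale separates edge levels from
  -- cluster levels, the other is demanded by `cost_le_sum_longCount`.
  obtain ⟨b, hb, rfl⟩ : ∃ b : ℝ, 0 < b ∧ c = b * 64 * 64 := ⟨c / 4096, by positivity, by ring⟩
  obtain ⟨m, hm⟩ : ∃ m : ℕ, ∀ u v : Fin (n + 1), dist (x u) (x v) < b * 64 * 64 ^ (m + 1) := by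
    obtain ⟨q₀, hq₀⟩ := Finite.exists_max fun q : Fin (n + 1) × Fin (n + 1) => dist (x q.1) (x q.2)
    obtain ⟨m, hm⟩ := pow_unbounded_of_one_lt (dist (x q₀.1) (x q₀.2) / (b * 64))
      (by norm_num : (1 : ℝ) < 64)
    refine ⟨m, fun u v => (hq₀ (u, v)).trans_lt ?_⟩
    rw [div_lt_iff₀ (by positivity)] at hm
    have : (64 : ℝ) ^ m ≤ 64 ^ (m + 1) := pow_le_pow_right₀ (by norm_num) (by omega)
    have := mul_le_mul_of_nonneg_right this (by positivity : 0 ≤ b * 64)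
    linarith
  have hm' : ∀ i ≤ n, ∀ j ≤ n, dist (x i) (x j) < b * 64 * 64 ^ (m + 1) := fun i hi j hj =>
    hm ⟨i, by omega⟩ ⟨j, by omega⟩
  set M : ℕ → ℝ := fun i => (compCount (proximityGraph x n (b * 64 ^ i)) : ℝ) - 1 with hM
  have hM0 : ∀ i, 0 ≤ M i := fun i => by
    have : (1 : ℝ) ≤ compCount (proximityGraph x n (b * 64 ^ i)) := by
      exact_mod_cast compCount_pos (proximityGraph x n (b * 64 ^ i))
    simp only [hM]
    linarith
  have hopt : ∑ i ∈ Finset.range m, M i * (b * 64 ^ i) ≤ 4 * steinerOpt (x '' Set.Iic n) :=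
    sum_clusters_le_steinerOpt x n hb.le m
  have hopt0 : 0 ≤ steinerOpt (x '' Set.Iic n) := by
    have : 0 ≤ ∑ i ∈ Finset.range m, M i * (b * 64 ^ i) :=
      Finset.sum_nonneg fun i _ => mul_nonneg (hM0 i) (by positivity)
    linarith
  have hlevel : ∀ l ∈ Finset.range m, (treeLongCount x n (b * 64 * 64 ^ (l + 1)) : ℝ) ≤
      3 * ∑ i ∈ Finset.Ico l m, M i := fun l hl =>
    (Finset.single_le_sum (f := fun i => (treeLongCount x n (b * 64 * 64 ^ (i + 1)) : ℝ))
      (fun i _ => Nat.cast_nonneg _)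
      (Finset.left_mem_Ico.2 (Finset.mem_range.1 hl))).trans (sum_treeLongCount_le x hb hm')
  have hpos : 0 ≤ b * 64 * 64 ^ 2 := by positivity
  calc cost (fun i : Fin (n + 1) => x i) (greedyAlgorithm.output x n)
      ≤ ∑ l ∈ Finset.range m,
          (treeLongCount x n (b * 64 * 64 ^ (l + 1)) : ℝ) * (b * 64 * 64 ^ (l + 2)) :=
        cost_le_sum_longCount _ _ (by positivity) hcmin hm
    _ ≤ ∑ l ∈ Finset.range m, (3 * ∑ i ∈ Finset.Ico l m, M i) * (b * 64 * 64 ^ (l + 2)) :=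
        Finset.sum_le_sum fun l hl => mul_le_mul_of_nonneg_right (hlevel l hl) (by positivity)
    _ = 3 * 64 ^ 3 * ∑ l ∈ Finset.range m, ∑ i ∈ Finset.Ico l m, M i * (b * 64 ^ l) := by
        rw [Finset.mul_sum]
        refine Finset.sum_congr rfl fun l _ => ?_
        rw [← Finset.sum_mul]
        ring
    -- After the exchange, `M i` is multiplied by a geometric sum of at most `2 * (b * 64 ^ i)`. The
    -- constant becomes `3 * 64 ^ 3 * 2 * 4`, which is below `2 * 6 ^ 10`.
    _ = 3 * 64 ^ 3 * ∑ i ∈ Finset.range m, ∑ l ∈ Finset.range (i + 1), M i * (b * 64 ^ l) := by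
        congr 1
        refine Finset.sum_comm' fun l i => ?_
        simp only [Finset.mem_range, Finset.mem_Ico]
        omega
    _ ≤ 3 * 64 ^ 3 * ∑ i ∈ Finset.range m, 2 * (M i * (b * 64 ^ i)) := by
        refine mul_le_mul_of_nonneg_left (Finset.sum_le_sum fun i _ => ?_) (by norm_num)
        rw [← Finset.mul_sum]
        have := mul_le_mul_of_nonneg_left (sum_pow_levels_le hb.le i) (hM0 i)
        linarith
    _ ≤ 2 * 6 ^ 10 * steinerOpt (x '' Set.Iic n) := by
        rw [← Finset.mul_sum]
        linarith

/-- The denominator is at most `α * α ^ K`, so the ratio is at least `2 * α ^ (3 * K + 1)`; `α ≥ 6`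
and `K ≥ 10` suffice. -/
theorem le_competitiveRatio {α : ℝ} {K : ℕ} (hα : 6 ≤ α) (hK : (K : ℝ) = 2 * α ^ 2) :
    2 * 6 ^ 10 ≤ 2 * α ^ (4 * K + 2) / ((α - 1) * (α ^ K - 1)) := by
  have hK10 : 10 ≤ K := by
    have : (10 : ℝ) ≤ K := by rw [hK]; nlinarith
    exact_mod_cast this
  have h1 : 1 < α ^ K := one_lt_pow₀ (by linarith) (by omega)
  have hpow : 0 < α ^ K := by linarith
  rw [le_div_iff₀ (mul_pos (by linarith) (by linarith))]
  have h2 : (α - 1) * (α ^ K - 1) ≤ α * α ^ K :=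
    mul_le_mul (by linarith) (by linarith) (by linarith) (by linarith)
  have h3 : (6 : ℝ) ^ 10 ≤ α ^ (3 * K + 1) :=
    (pow_le_pow_left₀ (by norm_num) hα 10).trans (pow_le_pow_right₀ (by linarith) (by omega))
  have h4 : α ^ (4 * K + 2) = α ^ (3 * K + 1) * (α * α ^ K) := by
    rw [← pow_succ', ← pow_add]
    congr 1
    omega
  have h5 := mul_le_mul h3 h2 (mul_nonneg (by linarith) (by linarith)) (by positivity)
  rw [h4]
  linarith

end Cost

end OnlineSteiner

theorem theorem1 (α : ℝ) (K : ℕ) (hα : 6 ≤ α) (hK : (K : ℝ) = 2 * α ^ 2) :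
    ∃ A : OnlineSteiner.OnlineAlgorithm,
      ∀ (X : Type*) [MetricSpace X] (x : ℕ → X) (n : ℕ),
        (A.output x n).IsTree ∧
        OnlineSteiner.IsArrivalStep (A.output x n) (A.output x (n + 1)) ∧
        OnlineSteiner.cost (fun i : Fin (n + 1) => x i) (A.output x n) ≤
          2 * α ^ (4 * K + 2) / ((α - 1) * (α ^ K - 1)) *
            OnlineSteiner.steinerOpt (x '' Set.Iic n) := by
  refine ⟨OnlineSteiner.greedyAlgorithm, fun X _ x n => ⟨OnlineSteiner.isTree_output x n,
    OnlineSteiner.isArrivalStep_output x n, (OnlineSteiner.cost_output_le x n).trans ?_⟩⟩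
  refine mul_le_mul_of_nonneg_right (OnlineSteiner.le_competitiveRatio hα hK)
    (Real.sInf_nonneg ?_)
  rintro c ⟨S, G, -, -, rfl⟩
  exact OnlineSteiner.cost_nonneg _ G
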